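/- Let $K$ be a connected, locally finite simplicial complex of dimension $n\ge 1$, every closed simplex $\Delta$ of which carries a smooth Riemannian metric $g_\Delta$ such that $g_\Delta$ restricts to $g_{\Delta'}$ on each face $\Delta'\subset\Delta$. Assume that $K$ is admissible: for every connected nonempty open $U\subset K$, the set $U\setminus K^{(n-2)}$ is connected and nonempty, where $K^{(n-2)}$ is the $(n-2)$-skeleton. Let $T_xK$ be the tangent cone of $K$ at $x$, the union of the tangent cones at $x$ of the simplices containing $x$; let $S_xK\subset T_xK$ be the link of unit vectors, $\Sigma K=\{(x,v): x\in K,\ v\in S_xK\}$ the space of links, and $\lambda_x$ the uniform probability measure on $S_xK$ (the normalized sum of the spherical volumes of the links of $x$ in the $n$-simplices containing $x$), regarded as a measure on $\Sigma K$ carried by $\{x\}\times S_xK$. A generalized geodesic is a curve that is a finite concatenation, on every compact time interval, of geodesics running in the interiors of $n$-simplices, which at each junction passes transversally, through an interior point of an $(n-1)$-simplex, from one $n$-simplex to a different one, keeping its speed and the component of its velocity tangent to the $(n-1)$-simplex. Call $z=(x,v)\in\Sigma K$ regular if some generalized geodesic starts at $x$ with initial velocity $v$, and every such generalized geodesic defined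 on $[0,T)$ with $T<\infty$ can be continued beyond $T$, whichever simplices it chose at the passages. Let $X:\Sigma K\times\mathbb R^+\to K$, $(z,t)\mapsto X_z(t)$, be (the projection to $K$ of) a generalized geodesic flow, that is: $z\mapsto X_z(t)$ is measurable for every $t$, $t\mapsto X_z(t)$ is continuous with $X_{(x,v)}(0)=x$, and for regular $z=(x,v)$ the curve $X_z$ is on $[0,\infty)$ a generalized geodesic with initial velocity $v$ (for other $z$, where the geodesic flow is not defined, it may be any continuous path). Put $X_{\eta z}(r):=X_z(\eta r)$ for $\eta>0$. Fix $\eta>0$ and $x\in K$. Then there is exactly one probability measure $P^x$ on the space of sequences $\omega=(Z_k,\tau_k)_{k\ge0}$ in $\Sigma K\times\mathbb R^+$ under which $(Z_0,\tau_0)$ has law $\lambda_x\otimes\delta_0$ and, for all $k$ and all measurable $B\subset\Sigma K\times\mathbb R^+$, $$P^x\big((Z_{k+1},\tau_{k+1})\in B\mid (Z_0,\tau_0),\dots,(Z_k,\tau_k)\big)=\int_0^\infty e^{-r}\,\lambda_{X_{\eta Z_k}(r)}\big(\{z:(z,\tau_k+r)\in B\}\big)\,dr .$$ Let $K_D=K\cup\{D\}$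 be the one-point compactification of $K$ (with $D$ isolated if $K$ is compact), and define the rescaled isotropic transport process $Y^\eta$, started at $x$, by $Y^\eta_t=X_{\eta Z_i}\big(\tfrac{t}{\eta^2}-\tau_i\big)$ if $\tau_i\le \tfrac{t}{\eta^2}<\tau_{i+1}$ (for the least such $i$) and $Y^\eta_t=D$ if there is no such $i$. Then each $Y^\eta_t$ is $P^x$-almost everywhere measurable, $P^x$-almost every path of $Y^\eta$ is a continuous path in $K$ defined for all $t\ge 0$, and the joint laws $P^\eta_J$ of $(Y^\eta_t)_{t\in J}$ under $P^x$, for finite $J\subset\mathbb R^+$, form a projective family on $K_D$. Moreover $Y^\eta$ induces a measure on the path space: there is exactly one probability measure $\mu_\eta$ on the Borel sets of $C(\mathbb R^+,K)$ (with the compact-open topology) such that, for every finite $J\subset\mathbb R^+$, the image of $\mu_\eta$ under $f\mapsto (f(t))_{t\in J}$ is $P^\eta_J$. -/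

import Mathlib

open Set Filter Topology MeasureTheory
open scoped NNReal ENNReal

noncomputable section

/-- The closed simplex spanned by the finite vertex set `s`, in barycentric coordinates. -/
def cell {V : Type*} (s : Finset V) : Set (V → ℝ) :=
  {x | (∀ v, 0 ≤ x v) ∧ (∀ v, v ∉ s → x v = 0) ∧ ∑ v ∈ s, x v = 1}

/-- The relative interior of the simplex spanned by `s`. -/
def openCell {V : Type*} (s : Finset V) : Set (V → ℝ) :=
  {x | x ∈ cell s ∧ ∀ v ∈ s, 0 < x v}

/-- The vectors tangent to the affine hull of the simplex spanned by `s`. -/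
def cellTangent {V : Type*} (s : Finset V) : Set (V → ℝ) :=
  {u | (∀ v, v ∉ s → u v = 0) ∧ ∑ v ∈ s, u v = 0}

/-- The tangent cone at `x` of the simplex spanned by `s`: the tangent vectors at `x` that
point into the simplex. -/
def cellCone {V : Type*} (s : Finset V) (x : V → ℝ) : Set (V → ℝ) :=
  {u | u ∈ cellTangent s ∧ ∀ v ∈ s, x v = 0 → 0 ≤ u v}

/-- A locally finite simplicial complex on the vertex set `V` with a piecewise smooth Riemannian
metric: a smooth Riemannian metric on each closed simplex, such that the metric of a
simplex restricts to the metrics of its faces. The metric of a simplex is written in barycentric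
coordinates; only its values at points of the simplex and on vectors tangent to the
simplex matter. A smooth metric on a neighbourhood of the (compact) simplex can be cut off, so
smoothness is asked of a globally defined extension, on which no positivity is imposed. -/
structure RiemannianComplex (V : Type*) extends AbstractSimplicialComplex V where
  locallyFinite : ∀ v : V, {s | s ∈ faces ∧ v ∈ s}.Finite
  metric : (s : Finset V) → (s → ℝ) → ((s → ℝ) →L[ℝ] (s → ℝ) →L[ℝ] ℝ)
  smooth : ∀ s ∈ faces, ContDiff ℝ (⊤ : ℕ∞) (metric s)
  symm : ∀ s ∈ faces, ∀ x ∈ cell s, ∀ u ∈ cellTangent s, ∀ w ∈ cellTangent s,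
    metric s (s.restrict x) (s.restrict u) (s.restrict w) =
      metric s (s.restrict x) (s.restrict w) (s.restrict u)
  pos : ∀ s ∈ faces, ∀ x ∈ cell s, ∀ u ∈ cellTangent s, u ≠ 0 →
    0 < metric s (s.restrict x) (s.restrict u) (s.restrict u)
  compat : ∀ s ∈ faces, ∀ t ∈ faces, t ⊆ s → ∀ x ∈ cell t,
    ∀ u ∈ cellTangent t, ∀ w ∈ cellTangent t,
    metric s (s.restrict x) (s.restrict u) (s.restrict w) =
      metric t (t.restrict x) (t.restrict u) (t.restrict w)

namespace RiemannianComplex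

variable {V : Type*} (K : RiemannianComplex V)

/-- The Riemannian metric of the simplex `s` at the point `x`. -/
def inner (s : Finset V) (x u w : V → ℝ) : ℝ :=
  K.metric s (s.restrict x) (s.restrict u) (s.restrict w)

/-- The geometric realization, with the topology of pointwise convergence of the barycentric
coordinates. For a locally finite complex this is the weak topology, and also the topology of the
length metric defined by the Riemannian metrics. For connected `K` the vertex set is
countable, so that the σ-algebra induced by the coordinates is the Borel σ-algebra. -/
abbrev Space : Type _ := {x : V → ℝ // ∃ s ∈ K.faces, x ∈ cell s}

/-- The space of links: pairs `(x, u)` of a point `x` and a unit vector `u` in the tangent cone of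
`K` at `x`. The tangent cone is the union of the tangent cones at `x` of the simplices that
contain `x`. -/
abbrev LinkSpace : Type _ :=
  {z : (V → ℝ) × (V → ℝ) //
    ∃ s ∈ K.faces, z.1 ∈ cell s ∧ z.2 ∈ cellCone s z.1 ∧ K.inner s z.1 z.2 z.2 = 1}

/-- The base point of an element of the space of links. -/
def base (z : K.LinkSpace) : K.Space :=
  ⟨z.1.1, z.2.imp fun _ h => ⟨h.1, h.2.1⟩⟩

/-- The complex has dimension `n`. -/
def HasDimension (n : ℕ) : Prop :=
  (∀ s ∈ K.faces, s.card ≤ n + 1) ∧ ∃ s ∈ K.faces, s.card = n + 1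

/-- The `(n - 2)`-skeleton: the union of the simplices with at most `n - 1` vertices. -/
def codimTwoSkeleton (n : ℕ) : Set K.Space :=
  {x | ∃ s ∈ K.faces, s.card < n ∧ x.1 ∈ cell s}

/-- `K` is a connected admissible complex of dimension `n`: removing the `(n - 2)`-skeleton
from a connected (in particular nonempty) open set leaves a connected (in particular
nonempty) set. -/
def IsAdmissible (n : ℕ) : Prop :=
  ConnectedSpace K.Space ∧ K.HasDimension n ∧
    ∀ U : Set K.Space, IsOpen U → IsConnected U → IsConnected (U \ K.codimTwoSkeleton n)

/-! ### The uniform probability measure on the link -/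

section Link

open scoped Classical in
/-- The edge vectors from the vertex `o`, a basis of the tangent space of the
simplex `s` when `o ∈ s`. -/
def edge (s : Finset V) (o : V) (i : s.erase o) : V → ℝ :=
  Pi.single (i : V) 1 - Pi.single o 1

open scoped Classical in
/-- The Riemannian volume density of the simplex `s` at `x` in the coordinates given by the edge
vectors from the vertex `o`: the square root of the Gram determinant. -/
def volumeDensity (s : Finset V) (o : V) (x : V → ℝ) : ℝ :=
  Real.sqrt (Matrix.of fun i j : s.erase o => K.inner s x (edge s o i) (edge s o j)).det

open scoped Classical in
/-- The spherical volume on the unit vectors at `x` that point into the simplex `s`, up to the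
factor `dim s`: the volume of a set of unit vectors is the Riemannian (Lebesgue) volume of the
part of the unit ball of the tangent space that lies on the rays through the set.
It does not depend on the vertex `o ∈ s`. -/
def sectorVolume (s : Finset V) (o : V) (x : V → ℝ) : Measure (V → ℝ) :=
  ENNReal.ofReal (K.volumeDensity s o x) •
    ((volume.restrict {c : s.erase o → ℝ |
        (∑ i, c i • edge s o i) ∈ cellCone s x ∧
        0 < K.inner s x (∑ i, c i • edge s o i) (∑ i, c i • edge s o i) ∧
        K.inner s x (∑ i, c i • edge s o i) (∑ i, c i • edge s o i) ≤ 1}).map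
      fun c => (Real.sqrt (K.inner s x (∑ i, c i • edge s o i) (∑ i, c i • edge s o i)))⁻¹ •
        ∑ i, c i • edge s o i)

/-- The spherical volume on the link of `x`: the sum of the spherical volumes of the links of `x`
in the `n`-simplices that contain `x`. (The choice of vertex is immaterial.) -/
def linkVolume (n : ℕ) (x : V → ℝ) : Measure (V → ℝ) :=
  Measure.sum fun s : {s : Finset V // s ∈ K.faces ∧ s.card = n + 1 ∧ x ∈ cell s} =>
    K.sectorVolume s.1 (K.isRelLowerSet_faces s.2.1).1.choose x

/-- The uniform probability measure `λ_x` on the link of `x`, as a measure on the space of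
links that is carried by the fibre over `x`. -/
def uniformLink (n : ℕ) (x : K.Space) : Measure K.LinkSpace :=
  Measure.comap Subtype.val
    (((K.linkVolume n x.1 univ)⁻¹ • K.linkVolume n x.1).map fun u => (x.1, u))

end Link

/-! ### The generalized geodesic flow -/

/-- On `[a, b]` the curve `γ` is a geodesic of the simplex `s` with velocity `vel`, and it runs in
the interior of `s` on `(a, b)`. The geodesic equation is written as the Euler–Lagrange equation
`d/dt g(γ', w) = ½ (∂_w g)(γ', γ')` for the constant tangent vectors `w`. -/
def IsGeodesicSegment (s : Finset V) (γ vel : ℝ → V → ℝ) (a b : ℝ) : Prop :=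
  (∀ t ∈ Icc a b, γ t ∈ cell s) ∧
  (∀ t ∈ Ioo a b, γ t ∈ openCell s) ∧
  (∀ t ∈ Icc a b, ∀ v, HasDerivWithinAt (fun τ => γ τ v) (vel t v) (Icc a b) t) ∧
  ∀ t ∈ Ioo a b, ∀ w ∈ cellTangent s,
    HasDerivAt (fun τ => K.inner s (γ τ) (vel τ) w)
      (1 / 2 * deriv (fun ε : ℝ => K.inner s (γ t + ε • w) (vel t) (vel t)) 0) t

/-- Transversal passage, at the point `p`, from the `n`-simplex `s` with velocity `u` to a
different `n`-simplex `s'` with velocity `u'`, through the interior of a common `(n-1)`-face: the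
component tangent to the face and the speed are kept, `u` points out of `s` and
`u'` points into `s'`. -/
def IsCrossing (n : ℕ) (s s' : Finset V) (p u u' : V → ℝ) : Prop :=
  s ≠ s' ∧ ∃ r ∈ K.faces, r.card = n ∧ r ⊆ s ∧ r ⊆ s' ∧ p ∈ openCell r ∧
    (∀ w ∈ cellTangent r, K.inner s p u w = K.inner s' p u' w) ∧
    K.inner s p u u = K.inner s' p u' u' ∧
    (∀ v ∈ s, v ∉ r → u v < 0) ∧ (∀ v ∈ s', v ∉ r → 0 < u' v)

/-- The curve `γ` is, on `[0, b]`, a generalized geodesic with initial point and direction `z`: it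
is a finite concatenation of geodesics in the interiors of `n`-simplices, which are
joined by transversal passages through interior points of `(n-1)`-simplices. -/
def IsGeneralizedGeodesic (n : ℕ) (z : K.LinkSpace) (γ : ℝ → V → ℝ) (b : ℝ) : Prop :=
  ∃ (N : ℕ) (τ : ℕ → ℝ) (s : ℕ → Finset V) (vel : ℕ → ℝ → V → ℝ),
    0 < N ∧ τ 0 = 0 ∧ τ N = b ∧ γ 0 = z.1.1 ∧ vel 0 0 = z.1.2 ∧
    (∀ i < N, τ i < τ (i + 1) ∧ s i ∈ K.faces ∧ (s i).card = n + 1 ∧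
      K.IsGeodesicSegment (s i) γ (vel i) (τ i) (τ (i + 1))) ∧
    ∀ i, i + 1 < N → K.IsCrossing n (s i) (s (i + 1)) (γ (τ (i + 1)))
      (vel i (τ (i + 1))) (vel (i + 1) (τ (i + 1)))

/-- `z` is a regular direction: a generalized geodesic starts in the direction `z`, and every
generalized geodesic from `z` on `[0, T)`, `T < ∞`, whichever simplices it has chosen at the
passages, can be continued beyond the time `T`. -/
def IsRegular (n : ℕ) (z : K.LinkSpace) : Prop :=
  (∃ γ : ℝ → V → ℝ, ∃ b > 0, K.IsGeneralizedGeodesic n z γ b) ∧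
  ∀ (γ : ℝ → V → ℝ) (T : ℝ), 0 < T → (∀ b ∈ Ioo 0 T, K.IsGeneralizedGeodesic n z γ b) →
    ∃ γ' : ℝ → V → ℝ, ∃ T' > T, EqOn γ γ' (Ico 0 T) ∧ K.IsGeneralizedGeodesic n z γ' T'

/-- `X` is (the projection to `K` of) a generalized geodesic flow. From a regular
direction `z` the trajectory `t ↦ X z t` is a generalized geodesic for all times, with a free
choice of the next simplex at each passage. The geodesic flow is not defined on the remaining
directions; there `X z` may be any continuous path from the base point of `z`. -/
structure IsGeodesicFlow (n : ℕ) (X : K.LinkSpace → ℝ≥0 → K.Space) : Prop where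
  measurable : ∀ t, Measurable fun z => X z t
  continuous : ∀ z, Continuous (X z)
  zero : ∀ z, X z 0 = K.base z
  geodesic : ∀ z, K.IsRegular n z → ∀ b > 0,
    K.IsGeneralizedGeodesic n z (fun t => (X z t.toNNReal).1) b

/-! ### The isotropic transport process -/

variable {K}

/-- The probability that the next (position, direction, time) triple lies in `B`, given that the
present one is `p`: with speed `η` one follows the trajectory of `X` for an exponential time `r`
of parameter one, and one chooses there a new direction, uniformly in the link. -/
def transitionProb (n : ℕ) (X : K.LinkSpace → ℝ≥0 → K.Space) (η : ℝ≥0)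
    (p : K.LinkSpace × ℝ≥0) (B : Set (K.LinkSpace × ℝ≥0)) : ℝ≥0∞ :=
  ∫⁻ r in Ici (0 : ℝ), ENNReal.ofReal (Real.exp (-r)) *
    K.uniformLink n (X p.1 (η * r.toNNReal)) {z | (z, p.2 + r.toNNReal) ∈ B}

/-- `P` is the law of the Markov chain of (position, direction, time) triples with the transition
probabilities above and with the initial law `λ_x ⊗ δ_0`. -/
def IsTransportLaw (n : ℕ) (X : K.LinkSpace → ℝ≥0 → K.Space) (η : ℝ≥0) (x : K.Space)
    (P : Measure (ℕ → K.LinkSpace × ℝ≥0)) : Prop :=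
  IsProbabilityMeasure P ∧
  P.map (fun ω => ω 0) = (K.uniformLink n x).map (fun z => (z, (0 : ℝ≥0))) ∧
  ∀ (k : ℕ) (A : Set (Finset.Iic k → K.LinkSpace × ℝ≥0)) (B : Set (K.LinkSpace × ℝ≥0)),
    MeasurableSet A → MeasurableSet B →
    P {ω | (Finset.Iic k).restrict ω ∈ A ∧ ω (k + 1) ∈ B} =
      ∫⁻ ω in {ω | (Finset.Iic k).restrict ω ∈ A}, transitionProb n X η (ω k) B ∂P

open scoped Classical in
/-- The rescaled isotropic transport process `Y^η` at time `t`, with values in `K` and a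
cemetery point `∞`: with `τ_i` the time component and `Z_i` the link component of `ω i`, it is
`X_{η Z_i}(t/η² - τ_i)` when `τ_i ≤ t/η² < τ_{i+1}`, and `∞` when there is no such `i`. Here
`X_{η z}(r) = X_z(η r)`. -/
def transportProcess (X : K.LinkSpace → ℝ≥0 → K.Space) (η : ℝ≥0) (t : ℝ≥0)
    (ω : ℕ → K.LinkSpace × ℝ≥0) : OnePoint K.Space :=
  if h : ∃ i, (ω i).2 ≤ t / η ^ 2 ∧ t / η ^ 2 < (ω (i + 1)).2 then
    ((X (ω (Nat.find h)).1 (η * (t / η ^ 2 - (ω (Nat.find h)).2)) : K.Space) :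
      OnePoint K.Space)
  else OnePoint.infty

/-- The Borel σ-algebra of the one-point compactification (for compact `K`, the added point is
isolated). -/
instance : MeasurableSpace (OnePoint K.Space) := borel _

/-- The Borel σ-algebra of the path space with the compact-open topology. -/
instance : MeasurableSpace C(ℝ≥0, K.Space) := borel _

/-- The law of `(Y^η_t)`, `t ∈ J`, when the underlying chain has the law `P`. -/
def finiteDimLaw (X : K.LinkSpace → ℝ≥0 → K.Space) (η : ℝ≥0)
    (P : Measure (ℕ → K.LinkSpace × ℝ≥0)) (J : Finset ℝ≥0) :
    Measure (J → OnePoint K.Space) :=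
  P.map fun ω t => transportProcess X η t ω

end RiemannianComplex

end

/-!
A point of the space of links and a waiting time determine, through the trajectories of `X`, the law
of the next point of the space of links. The triples (position, direction, time) therefore form a
Markov chain with the transition kernel `RiemannianComplex.transitionKernel`, whose law exists by
the Ionescu-Tulcea theorem (`exists_isMarkovChainLaw`) and is unique because the finite-dimensional
marginals are determined inductively (`IsMarkovChainLaw.eq`). For this, the uniform measures on
the links have to be probability measures that depend measurably on the base point. A connected
locally finite complex has countably many vertices (`RiemannianComplex.countable_vertices`), so
that its Borel structure is the one of a second countable metrizable space; admissibility gives an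
`n`-simplex at every point (`RiemannianComplex.IsAdmissible.exists_mem_cell`), so that the
spherical volume of a link is positive; and it is finite by local finiteness and because the unit
ball of a positive definite quadratic form is bounded.

Almost surely the waiting times are positive and each new direction is based at the end of the
preceding trajectory (`RiemannianComplex.ae_transitionKernel`). The jump times `τ_k` tend to
infinity, because the expectation of `exp (-τ_k)` is `2⁻¹ ^ k`, which is summable
(`RiemannianComplex.ae_exists_lt_time`). Hence almost every path is a locally finite concatenation
of continuous pieces, defined for all times.

The Borel σ-algebra of the path space is generated by the evaluations
(`borel_continuousMap_eq_comap_eval`), since the compact-open topology is second countable and a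
subbasic open set is determined by countably many evaluations. So a process with almost surely
continuous paths induces a measure on the path space, and this measure is determined by its
finite-dimensional laws (`existsUnique_pathMeasure`).
-/

noncomputable section

/-! ### The Borel sets of the path space -/

section PathSpace

variable {X Y : Type*} [TopologicalSpace X] [TopologicalSpace Y]

/-- The condition that a path maps a compact set into an open set is decided by countably many of
its values: an open set is the union of closed sets whose interiors exhaust it, and a closed
condition on a compact set can be tested on a dense sequence. -/
theorem measurableSet_mapsTo_of_eval [SecondCountableTopology X]
    [TopologicalSpace.PseudoMetrizableSpace Y] [MeasurableSpace Y] [BorelSpace Y]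
    {m : MeasurableSpace C(X, Y)} (hm : ∀ x, Measurable fun f : C(X, Y) => f x)
    {A : Set X} (hA : IsCompact A) {U : Set Y} (hU : IsOpen U) :
    MeasurableSet {f : C(X, Y) | MapsTo f A U} := by
  let := TopologicalSpace.pseudoMetrizableSpacePseudoMetric Y
  obtain ⟨D, hDc, hD⟩ := TopologicalSpace.exists_countable_dense A
  -- `F k` is the set of points at distance at least `1 / (k + 1)` from the complement of `U`.
  let F : ℕ → Set Y := fun k => {y | ((k : ℝ≥0∞) + 1)⁻¹ ≤ Metric.infEDist y Uᶜ}
  have hF : ∀ k, IsClosed (F k) := fun k =>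
    isClosed_le continuous_const Metric.continuous_infEDist
  have hU' : ∀ y, y ∈ U ↔ 0 < Metric.infEDist y Uᶜ := by
    intro y
    rw [pos_iff_ne_zero, ne_eq, ← Metric.mem_closure_iff_infEDist_zero,
      hU.isClosed_compl.closure_eq, notMem_compl_iff]
  have key : {f : C(X, Y) | MapsTo f A U} = ⋃ k, ⋂ d ∈ D, {f : C(X, Y) | f d.1 ∈ F k} := by
    ext f
    simp only [mem_ofPred_eq, mem_iUnion, mem_iInter]
    constructor
    · intro h
      have hcont : ContinuousOn (fun a => Metric.infEDist (f a) Uᶜ) A :=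
        (Metric.continuous_infEDist.comp f.continuous).continuousOn
      obtain ⟨ε, hε, hle⟩ : ∃ ε : ℝ≥0∞, 0 < ε ∧ ∀ a ∈ A, ε ≤ Metric.infEDist (f a) Uᶜ := by
        rcases A.eq_empty_or_nonempty with rfl | hne
        · exact ⟨1, one_pos, by simp⟩
        · obtain ⟨a, ha, hmin⟩ := hA.exists_isMinOn hne hcont
          exact ⟨_, (hU' _).1 (h ha), fun b hb => hmin hb⟩
      obtain ⟨k, hk⟩ := ENNReal.exists_inv_nat_lt hε.ne'
      refine ⟨k, fun d _ => le_trans ?_ (hle d.1 d.2)⟩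
      exact (ENNReal.inv_le_inv.2 le_self_add).trans hk.le
    · rintro ⟨k, hk⟩ a ha
      have hcl : IsClosed ((fun d : A => f d.1) ⁻¹' F k) :=
        (hF k).preimage (f.continuous.comp continuous_subtype_val)
      have h1 : closure D ⊆ (fun d : A => f d.1) ⁻¹' F k :=
        hcl.closure_subset_iff.2 fun d hd => hk d hd
      have h2 : f a ∈ F k := h1 (hD ⟨a, ha⟩)
      refine (hU' _).2 (lt_of_lt_of_le ?_ h2)
      exact ENNReal.inv_pos.2 (by finiteness)
  rw [key]
  exact MeasurableSet.iUnion fun k => MeasurableSet.biInter hDc fun d _ =>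
    hm d.1 (hF k).measurableSet

/-- The Borel σ-algebra of the compact-open topology is generated by the evaluations. -/
theorem borel_continuousMap_eq_comap_eval [SecondCountableTopology X] [LocallyCompactSpace X]
    [SecondCountableTopology Y] [TopologicalSpace.PseudoMetrizableSpace Y] [MeasurableSpace Y]
    [BorelSpace Y] :
    borel C(X, Y) = MeasurableSpace.comap (fun (f : C(X, Y)) x => f x) MeasurableSpace.pi := by
  apply le_antisymm
  · rw [borel_eq_generateFrom_of_subbasis ContinuousMap.compactOpen_eq]
    refine MeasurableSpace.generateFrom_le ?_
    rintro _ ⟨A, hA, U, hU, rfl⟩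
    refine measurableSet_mapsTo_of_eval (m := MeasurableSpace.comap _ _) (fun x => ?_) hA hU
    exact (measurable_pi_apply x).comp (comap_measurable _)
  · rw [← measurable_iff_comap_le, @measurable_pi_iff]
    intro x
    exact (continuous_eval_const x).borel_measurable.mono le_rfl
      (BorelSpace.measurable_eq (α := Y)).le

theorem measurable_continuousMap_of_eval [SecondCountableTopology X] [LocallyCompactSpace X]
    [SecondCountableTopology Y] [TopologicalSpace.PseudoMetrizableSpace Y] [MeasurableSpace Y]
    [BorelSpace Y] [MeasurableSpace C(X, Y)] [BorelSpace C(X, Y)] {Ω : Type*} [MeasurableSpace Ω]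
    {Φ : Ω → C(X, Y)} (h : ∀ x, Measurable fun ω => Φ ω x) : Measurable Φ := by
  intro S hS
  rw [(BorelSpace.measurable_eq (α := C(X, Y))).trans borel_continuousMap_eq_comap_eval] at hS
  obtain ⟨T, hT, rfl⟩ := hS
  exact measurable_pi_iff.2 h hT

end PathSpace

/-! ### Measures on the path space with given finite-dimensional laws -/

section PathLaw

variable {E : Type*} [TopologicalSpace E] [MeasurableSpace (OnePoint E)] [BorelSpace (OnePoint E)]
  [MeasurableSpace C(ℝ≥0, E)] [BorelSpace C(ℝ≥0, E)]

theorem measurable_coe_eval (t : ℝ≥0) : Measurable fun f : C(ℝ≥0, E) => (f t : OnePoint E) :=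
  (OnePoint.continuous_coe.comp (continuous_eval_const t)).measurable

variable [MeasurableSpace E] [BorelSpace E]

theorem measurableEmbedding_coe_onePoint {E : Type*} [TopologicalSpace E]
    [MeasurableSpace (OnePoint E)] [BorelSpace (OnePoint E)] [MeasurableSpace E] [BorelSpace E] :
    MeasurableEmbedding ((↑) : E → OnePoint E) :=
  OnePoint.isOpenEmbedding_coe.measurableEmbedding

variable [SecondCountableTopology E] [TopologicalSpace.PseudoMetrizableSpace E]

/-- The σ-algebra generated by the evaluations in `E` is also generated by the evaluations in the
one-point compactification, in which `E` is open. -/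
theorem ext_of_finiteDimLaw {μ ν : Measure C(ℝ≥0, E)} [IsProbabilityMeasure μ]
    (h : ∀ J : Finset ℝ≥0, μ.map (fun f (t : J) => (f t : OnePoint E)) =
      ν.map fun f (t : J) => (f t : OnePoint E)) : μ = ν := by
  let e : C(ℝ≥0, E) → ℝ≥0 → OnePoint E := fun f t => f t
  have he : Measurable e := measurable_pi_iff.2 measurable_coe_eval
  have hle : (inferInstance : MeasurableSpace C(ℝ≥0, E)) ≤
      MeasurableSpace.comap e MeasurableSpace.pi := by
    rw [(BorelSpace.measurable_eq (α := C(ℝ≥0, E))).trans borel_continuousMap_eq_comap_eval,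
      ← measurable_iff_comap_le, @measurable_pi_iff]
    intro t
    rw [← measurableEmbedding_coe_onePoint.measurable_comp_iff]
    exact (measurable_pi_apply t).comp (comap_measurable e)
  have := Measure.isProbabilityMeasure_map (μ := μ) he.aemeasurable
  have hmap : μ.map e = ν.map e := by
    have hfin : ∀ J : Finset ℝ≥0,
        IsFiniteMeasure ((μ.map e).map (J.restrict (π := fun _ => OnePoint E))) :=
      fun J => inferInstance
    refine IsProjectiveLimit.unique
      (P := fun J => (μ.map e).map (J.restrict (π := fun _ => OnePoint E))) (fun J => rfl)
      fun J => ?_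
    dsimp only
    rw [Measure.map_map (Finset.measurable_restrict J) he,
      Measure.map_map (Finset.measurable_restrict J) he]
    exact (h J).symm
  ext S hS
  obtain ⟨T, hT, rfl⟩ := hle S hS
  rw [← Measure.map_apply he hT, hmap, Measure.map_apply he hT]

/-- A process with almost surely continuous paths in `E` induces a unique measure on the path
space. -/
theorem existsUnique_pathMeasure {Ω : Type*} [MeasurableSpace Ω] {P : Measure Ω}
    [IsProbabilityMeasure P] {Y : ℝ≥0 → Ω → OnePoint E} (hY : ∀ t, Measurable (Y t))
    (hcont : ∀ᵐ ω ∂P, ∃ f : C(ℝ≥0, E), ∀ t, Y t ω = (f t : OnePoint E)) :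
    ∃! μ : Measure C(ℝ≥0, E), IsProbabilityMeasure μ ∧
      ∀ J : Finset ℝ≥0, μ.map (fun f (t : J) => (f t : OnePoint E)) =
        P.map fun ω (t : J) => Y t ω := by
  classical
  obtain ⟨N, hN, hNm, hNP⟩ := exists_measurable_superset_of_null (ae_iff.1 hcont)
  have hgood : ∀ ω ∉ N, ∃ f : C(ℝ≥0, E), ∀ t, Y t ω = (f t : OnePoint E) := fun ω hω =>
    by_contra fun h => hω (hN h)
  have hNc : ∀ᵐ ω ∂P, ω ∉ N := measure_eq_zero_iff_ae_notMem.1 hNP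
  obtain ⟨ω₀, hω₀⟩ := hNc.exists
  have : Nonempty C(ℝ≥0, E) := ⟨(hgood ω₀ hω₀).choose⟩
  choose! f hf using hgood
  let Φ : Ω → C(ℝ≥0, E) := fun ω => if ω ∈ N then f ω₀ else f ω
  have hΦY : ∀ ω ∉ N, ∀ t, (Φ ω t : OnePoint E) = Y t ω := fun ω hω t => by
    simp only [Φ, if_neg hω, hf ω hω]
  have hΦ : Measurable Φ := by
    refine measurable_continuousMap_of_eval fun t => ?_
    rw [← measurableEmbedding_coe_onePoint.measurable_comp_iff]
    have : (fun x : E => (x : OnePoint E)) ∘ (fun ω => Φ ω t) =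
        fun ω => if ω ∈ N then (f ω₀ t : OnePoint E) else Y t ω := by
      ext1 ω
      by_cases hω : ω ∈ N
      · simp only [Function.comp_apply, Φ, if_pos hω]
      · simp only [Function.comp_apply, hΦY ω hω t, if_neg hω]
    rw [this]
    exact Measurable.ite hNm measurable_const (hY t)
  have hprob := Measure.isProbabilityMeasure_map (μ := P) hΦ.aemeasurable
  have hlaw : ∀ J : Finset ℝ≥0, (P.map Φ).map (fun f (t : J) => (f t : OnePoint E)) =
      P.map fun ω (t : J) => Y t ω := by
    intro J
    have hJ : Measurable fun (f : C(ℝ≥0, E)) (t : J) => (f t : OnePoint E) :=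
      measurable_pi_iff.2 fun t => measurable_coe_eval t.1
    rw [Measure.map_map hJ hΦ]
    refine Measure.map_congr ?_
    filter_upwards [hNc] with ω hω
    ext1 t
    exact hΦY ω hω t
  refine ⟨P.map Φ, ⟨hprob, hlaw⟩, fun ν hν => ?_⟩
  exact (ext_of_finiteDimLaw fun J => (hlaw J).trans (hν.2 J).symm).symm

end PathLaw

/-! ### Concatenation of paths -/

theorem exists_le_and_lt_succ {τ : ℕ → ℝ≥0} (h0 : τ 0 = 0) (htop : ∀ t, ∃ k, t < τ k) (t : ℝ≥0) :
    ∃ i, τ i ≤ t ∧ t < τ (i + 1) := by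
  classical
  have h := Nat.find_spec (htop t)
  obtain ⟨i, hi⟩ : ∃ i, Nat.find (htop t) = i + 1 := by
    refine Nat.exists_eq_succ_of_ne_zero fun hz => ?_
    rw [hz, h0] at h
    exact not_lt_bot h
  exact ⟨i, not_lt.1 (Nat.find_min (htop t) (by omega)), hi ▸ h⟩

/-- Continuous functions that agree at consecutive breakpoints tending to infinity can be
concatenated to a continuous function. -/
theorem exists_continuousMap_concat {E : Type*} [TopologicalSpace E] {τ : ℕ → ℝ≥0}
    (hτ : StrictMono τ) (h0 : τ 0 = 0) (htop : ∀ t, ∃ k, t < τ k) {g : ℕ → ℝ≥0 → E}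
    (hg : ∀ i, Continuous (g i)) (hgg : ∀ i, g i (τ (i + 1)) = g (i + 1) (τ (i + 1))) :
    ∃ f : C(ℝ≥0, E), ∀ i t, τ i ≤ t → t < τ (i + 1) → f t = g i t := by
  choose idx h1 h2 using exists_le_and_lt_succ h0 htop
  have huniq : ∀ i t, τ i ≤ t → t < τ (i + 1) → idx t = i := by
    intro i t hi hi'
    have ha := hτ.lt_iff_lt.1 ((h1 t).trans_lt hi')
    have hb := hτ.lt_iff_lt.1 (hi.trans_lt (h2 t))
    omega
  refine ⟨⟨fun t => g (idx t) t, ?_⟩, fun i t hi hi' => by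
    change g (idx t) t = g i t
    rw [huniq i t hi hi']⟩
  refine LocallyFinite.continuous (f := fun i => Icc (τ i) (τ (i + 1))) ?_ ?_
    (fun i => isClosed_Icc) fun i => ?_
  · intro t
    obtain ⟨N, hN⟩ := htop t
    refine ⟨Iio (τ N), Iio_mem_nhds hN, (finite_lt_nat N).subset ?_⟩
    rintro i ⟨s, hs, hsN⟩
    exact hτ.lt_iff_lt.1 (hs.1.trans_lt hsN)
  · exact eq_univ_of_forall fun t => mem_iUnion.2 ⟨idx t, h1 t, (h2 t).le⟩
  · refine (hg i).continuousOn.congr fun t ht => ?_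
    rcases ht.2.lt_or_eq with h | h
    · simp only [huniq i t ht.1 h]
    · have : idx t = i + 1 := huniq (i + 1) t h.ge (h ▸ hτ (Nat.lt_succ_self _))
      simp only [this]
      rw [h]
      exact (hgg i).symm

/-! ### Markov chains with a given transition kernel -/

section MarkovChain

open ProbabilityTheory Preorder

variable {α : Type*} [MeasurableSpace α]

/-- `P` is the law of a homogeneous Markov chain with initial law `μ₀` and transition kernel `κ`. -/
structure IsMarkovChainLaw (μ₀ : Measure α) (κ : Kernel α α) (P : Measure (ℕ → α)) : Prop where
  isProbabilityMeasure : IsProbabilityMeasure P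
  initial : P.map (fun ω => ω 0) = μ₀
  step : ∀ (k : ℕ) (A : Set (Finset.Iic k → α)) (B : Set α), MeasurableSet A → MeasurableSet B →
    P {ω | (Finset.Iic k).restrict ω ∈ A ∧ ω (k + 1) ∈ B} =
      ∫⁻ ω in {ω | (Finset.Iic k).restrict ω ∈ A}, κ (ω k) B ∂P

/-- The transition kernel of a homogeneous chain as a function of the history up to time `k`. -/
def historyKernel (κ : Kernel α α) (k : ℕ) : Kernel (Finset.Iic k → α) α :=
  κ.comap (fun h => h ⟨k, Finset.mem_Iic.2 le_rfl⟩) (measurable_pi_apply _)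

instance (κ : Kernel α α) [IsMarkovKernel κ] (k : ℕ) : IsMarkovKernel (historyKernel κ k) := by
  unfold historyKernel
  infer_instance

variable {μ₀ : Measure α} {κ : Kernel α α} {P P' : Measure (ℕ → α)}

theorem setLIntegral_historyKernel (k : ℕ) {A : Set (Finset.Iic k → α)} {B : Set α}
    (hA : MeasurableSet A) (hB : MeasurableSet B) :
    ∫⁻ ω in {ω | (Finset.Iic k).restrict ω ∈ A}, κ (ω k) B ∂P =
      ∫⁻ h in A, historyKernel κ k h B ∂P.map (frestrictLe k) := by
  rw [setLIntegral_map hA (Kernel.measurable_coe _ hB) (measurable_frestrictLe k)]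
  rfl

theorem IsMarkovChainLaw.ae_zero (h : IsMarkovChainLaw μ₀ κ P) {p : α → Prop}
    (hp : ∀ᵐ a ∂μ₀, p a) : ∀ᵐ ω ∂P, p (ω 0) := by
  rw [← h.initial] at hp
  exact ae_of_ae_map (measurable_pi_apply 0).aemeasurable hp

variable [IsMarkovKernel κ]

theorem IsMarkovChainLaw.map_prodMk (h : IsMarkovChainLaw μ₀ κ P) (k : ℕ) :
    P.map (fun ω => (frestrictLe k ω, ω (k + 1))) = P.map (frestrictLe k) ⊗ₘ historyKernel κ k := by
  have := h.isProbabilityMeasure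
  have hm : Measurable fun ω : ℕ → α => (frestrictLe (π := fun _ => α) k ω, ω (k + 1)) :=
    (measurable_frestrictLe k).prodMk (measurable_pi_apply _)
  have := Measure.isProbabilityMeasure_map (μ := P) hm.aemeasurable
  refine Measure.ext_prod fun {A B} hA hB => ?_
  rw [Measure.map_apply hm (hA.prod hB), Measure.compProd_apply_prod hA hB,
    ← setLIntegral_historyKernel k hA hB, ← h.step k A B hA hB]
  rfl

/-- The finite-dimensional marginals are determined inductively by the initial law and the
transition kernel. -/
theorem IsMarkovChainLaw.eq (h : IsMarkovChainLaw μ₀ κ P) (h' : IsMarkovChainLaw μ₀ κ P') :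
    P = P' := by
  have := h.isProbabilityMeasure
  have := h'.isProbabilityMeasure
  have key : ∀ k, P.map (frestrictLe (π := fun _ => α) k) = P'.map (frestrictLe k) := by
    intro k
    induction k with
    | zero =>
      let e : α → (Finset.Iic 0 → α) := fun a _ => a
      have he : Measurable e := measurable_pi_iff.2 fun _ => measurable_id
      have hcomp : (frestrictLe 0 : (ℕ → α) → _) = e ∘ fun ω => ω 0 := by
        ext ω i
        have : i.1 = 0 := Nat.le_zero.1 (Finset.mem_Iic.1 i.2)
        simp [e, frestrictLe, this]
      rw [hcomp, ← Measure.map_map he (measurable_pi_apply 0), h.initial,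
        ← Measure.map_map he (measurable_pi_apply 0), h'.initial]
    | succ k ih =>
      let e : (Finset.Iic k → α) × α → (Finset.Iic (k + 1) → α) := fun p i =>
        if hi : i.1 ≤ k then p.1 ⟨i, Finset.mem_Iic.2 hi⟩ else p.2
      have he : Measurable e := by
        refine measurable_pi_iff.2 fun i => ?_
        by_cases hi : i.1 ≤ k
        · simp only [e, hi, dif_pos]
          exact (measurable_pi_apply _).comp measurable_fst
        · simp only [e, hi, dif_neg, not_false_eq_true]
          exact measurable_snd
      have hm : Measurable fun ω : ℕ → α => (frestrictLe (π := fun _ => α) k ω, ω (k + 1)) :=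
        (measurable_frestrictLe k).prodMk (measurable_pi_apply _)
      have hcomp : (frestrictLe (k + 1) : (ℕ → α) → _) =
          e ∘ fun ω => (frestrictLe k ω, ω (k + 1)) := by
        ext ω i
        by_cases hi : i.1 ≤ k
        · simp [e, frestrictLe, hi]
        · have : i.1 = k + 1 := by
            have := Finset.mem_Iic.1 i.2
            omega
          simp [e, frestrictLe, this]
      rw [hcomp, ← Measure.map_map he hm, h.map_prodMk, ← Measure.map_map he hm,
        h'.map_prodMk, ih]
  have hfin : ∀ I : Finset ℕ, IsFiniteMeasure (P.map (I.restrict (π := fun _ => α))) :=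
    fun I => inferInstance
  refine IsProjectiveLimit.unique (P := fun I => P.map (I.restrict (π := fun _ => α)))
    (fun I => rfl) fun I => ?_
  have hI : I ⊆ Finset.Iic (I.sup id) := fun i hi => Finset.mem_Iic.2 (Finset.le_sup (f := id) hi)
  have hcomp : (I.restrict (π := fun _ : ℕ => α)) =
      Finset.restrict₂ hI ∘ frestrictLe (I.sup id) := rfl
  rw [hcomp, ← Measure.map_map (Finset.measurable_restrict₂ hI) (measurable_frestrictLe _), ← key,
    Measure.map_map (Finset.measurable_restrict₂ hI) (measurable_frestrictLe _)]
  rfl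

/-- The Ionescu-Tulcea theorem, for a homogeneous Markov chain. -/
theorem exists_isMarkovChainLaw (μ₀ : Measure α) [IsProbabilityMeasure μ₀] (κ : Kernel α α)
    [IsMarkovKernel κ] : ∃ P, IsMarkovChainLaw μ₀ κ P := by
  let P : Measure (ℕ → α) := Kernel.trajMeasure (X := fun _ => α) μ₀ (historyKernel κ)
  have hP : IsProbabilityMeasure P := by
    unfold P
    infer_instance
  refine ⟨P, hP, ?_, fun k A B hA hB => ?_⟩
  · let e : (Finset.Iic 0 → α) → α := fun h => h ⟨0, Finset.mem_Iic.2 le_rfl⟩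
    have he : Measurable e := measurable_pi_apply _
    have hcomp : (fun ω : ℕ → α => ω 0) = e ∘ frestrictLe 0 := rfl
    rw [hcomp, ← Measure.map_map he (measurable_frestrictLe _)]
    unfold P
    rw [Kernel.trajMeasure, Measure.map_comp _ _ (measurable_frestrictLe _),
      Kernel.traj_map_frestrictLe, Kernel.partialTraj_self, Measure.id_comp,
      Measure.map_map he (MeasurableEquiv.measurable _)]
    exact Measure.map_id
  · have hm : Measurable fun ω : ℕ → α => (frestrictLe (π := fun _ => α) k ω, ω (k + 1)) :=
      (measurable_frestrictLe k).prodMk (measurable_pi_apply _)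
    have h := Kernel.map_frestrictLe_trajMeasure_compProd_eq_map_trajMeasure
      (X := fun _ => α) (μ₀ := μ₀) (κ := historyKernel κ) (a := k)
    rw [setLIntegral_historyKernel k hA hB, ← Measure.compProd_apply_prod hA hB]
    have h1 := congrArg (fun m => m (A ×ˢ B)) h
    simp only [Measure.map_apply hm (hA.prod hB)] at h1
    exact h1.symm

/-- A transition property that has probability one from every state holds almost surely at every
step. -/
theorem IsMarkovChainLaw.ae_step (h : IsMarkovChainLaw μ₀ κ P) {R : Set (α × α)}
    (hR : MeasurableSet R) (hκ : ∀ a, ∀ᵐ b ∂κ a, (a, b) ∈ R) :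
    ∀ᵐ ω ∂P, ∀ k, (ω k, ω (k + 1)) ∈ R := by
  have := h.isProbabilityMeasure
  refine ae_all_iff.2 fun k => ?_
  let g : (Finset.Iic k → α) × α → α × α := fun p => (p.1 ⟨k, Finset.mem_Iic.2 le_rfl⟩, p.2)
  have hg : Measurable g :=
    ((measurable_pi_apply _).comp measurable_fst).prodMk measurable_snd
  have hm : Measurable fun ω : ℕ → α => (frestrictLe (π := fun _ => α) k ω, ω (k + 1)) :=
    (measurable_frestrictLe k).prodMk (measurable_pi_apply _)
  have h1 : ∀ᵐ p ∂(P.map (frestrictLe (π := fun _ => α) k) ⊗ₘ historyKernel κ k), g p ∈ R :=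
    (Measure.ae_compProd_iff (hg hR)).2 (Eventually.of_forall fun a => hκ _)
  rw [← h.map_prodMk k] at h1
  exact ae_of_ae_map hm.aemeasurable h1

theorem IsMarkovChainLaw.lintegral_succ (h : IsMarkovChainLaw μ₀ κ P) {f : α → ℝ≥0∞}
    (hf : Measurable f) (k : ℕ) :
    ∫⁻ ω, f (ω (k + 1)) ∂P = ∫⁻ ω, ∫⁻ b, f b ∂κ (ω k) ∂P := by
  have := h.isProbabilityMeasure
  have hm : Measurable fun ω : ℕ → α => (frestrictLe (π := fun _ => α) k ω, ω (k + 1)) :=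
    (measurable_frestrictLe k).prodMk (measurable_pi_apply _)
  have hf' : Measurable fun p : (Finset.Iic k → α) × α => f p.2 := hf.comp measurable_snd
  have h1 := congrArg (fun m => ∫⁻ p, f p.2 ∂m) (h.map_prodMk k)
  rw [lintegral_map hf' hm, Measure.lintegral_compProd hf',
    lintegral_map hf'.lintegral_kernel_prod_right' (measurable_frestrictLe k)] at h1
  exact h1

end MarkovChain

/-! ### Exponential waiting times -/

/-- The exponential law with parameter one, as a measure on the nonnegative reals. -/
def expWaitingTime : Measure ℝ≥0 :=
  ((volume.restrict (Ici (0 : ℝ))).withDensity fun r => ENNReal.ofReal (Real.exp (-r))).map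
    Real.toNNReal

theorem lintegral_expWaitingTime {f : ℝ≥0 → ℝ≥0∞} (hf : Measurable f) :
    ∫⁻ r, f r ∂expWaitingTime =
      ∫⁻ r in Ici (0 : ℝ), ENNReal.ofReal (Real.exp (-r)) * f r.toNNReal := by
  have hf' : Measurable fun r : ℝ => f r.toNNReal := hf.comp measurable_real_toNNReal
  rw [expWaitingTime, lintegral_map hf measurable_real_toNNReal,
    lintegral_withDensity_eq_lintegral_mul _ (by fun_prop) hf']
  rfl

theorem lintegral_exp_neg_mul {a : ℝ} (ha : 0 < a) :
    ∫⁻ r in Ici (0 : ℝ), ENNReal.ofReal (Real.exp (-a * r)) = ENNReal.ofReal a⁻¹ := by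
  rw [setLIntegral_congr Ioi_ae_eq_Ici.symm, ← ofReal_integral_eq_lintegral_ofReal
    (integrableOn_exp_mul_Ioi (neg_lt_zero.2 ha) 0)
    (Eventually.of_forall fun r => (Real.exp_pos _).le),
    integral_exp_mul_Ioi (neg_lt_zero.2 ha)]
  simp [neg_div_neg_eq]

instance : IsProbabilityMeasure expWaitingTime := by
  constructor
  rw [← lintegral_one, lintegral_expWaitingTime measurable_const]
  simpa using lintegral_exp_neg_mul one_pos

theorem ae_pos_expWaitingTime : ∀ᵐ r ∂expWaitingTime, 0 < r := by
  have hm : MeasurableSet {r : ℝ≥0 | 0 < r} := measurableSet_Ioi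
  rw [expWaitingTime, ae_map_iff measurable_real_toNNReal.aemeasurable hm]
  refine (withDensity_absolutelyContinuous _ _).ae_le ?_
  rw [← restrict_Ioi_eq_restrict_Ici]
  filter_upwards [ae_restrict_mem measurableSet_Ioi] with r hr
  exact Real.toNNReal_pos.2 hr

/-- The Laplace transform of the exponential law at one is `1 / 2`. -/
theorem lintegral_exp_neg_expWaitingTime :
    ∫⁻ r, ENNReal.ofReal (Real.exp (-(r : ℝ))) ∂expWaitingTime = 2⁻¹ := by
  rw [lintegral_expWaitingTime (by fun_prop)]
  have h := lintegral_exp_neg_mul two_pos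
  rw [ENNReal.ofReal_inv_of_pos two_pos, ENNReal.ofReal_ofNat] at h
  rw [← h]
  refine setLIntegral_congr_fun measurableSet_Ici fun r hr => ?_
  rw [← ENNReal.ofReal_mul (Real.exp_pos _).le, ← Real.exp_add, Real.coe_toNNReal r hr]
  ring_nf

namespace RiemannianComplex

variable {V : Type*} (K : RiemannianComplex V)

/-! ### Combinatorics of cells -/

section Cells

theorem cell_mono {t s : Finset V} (h : t ⊆ s) : cell t ⊆ cell s := by
  intro x hx
  refine ⟨hx.1, fun v hv => hx.2.1 v fun hvt => hv (h hvt), ?_⟩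
  rw [← hx.2.2]
  exact (Finset.sum_subset h fun v _ hvt => hx.2.1 v hvt).symm

theorem subset_of_pos_of_mem_cell {t s : Finset V} {x : V → ℝ} (ht : ∀ v ∈ t, 0 < x v)
    (hx : x ∈ cell s) : t ⊆ s := by
  intro v hv
  by_contra hvs
  exact (ht v hv).ne' (hx.2.1 v hvs)

/-- Every point of a simplex lies in the relative interior of a unique face, its carrier. -/
theorem exists_mem_openCell {s : Finset V} (hs : s ∈ K.faces) {x : V → ℝ} (hx : x ∈ cell s) :
    ∃ t ∈ K.faces, x ∈ openCell t := by
  classical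
  have hsum : ∑ v ∈ s.filter (fun v => x v ≠ 0), x v = 1 := by
    rw [Finset.sum_filter_ne_zero, hx.2.2]
  have hne : (s.filter fun v => x v ≠ 0).Nonempty := by
    rw [Finset.nonempty_iff_ne_empty]
    intro h
    rw [h] at hsum
    simp at hsum
  refine ⟨s.filter fun v => x v ≠ 0,
    (K.isRelLowerSet_faces hs).2 (Finset.filter_subset _ _) hne, ⟨hx.1, ?_, hsum⟩, ?_⟩
  · intro v hv
    by_contra h
    exact hv (Finset.mem_filter.2 ⟨by_contra fun hvs => h (hx.2.1 v hvs), h⟩)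
  · intro v hv
    exact lt_of_le_of_ne (hx.1 v) (Finset.mem_filter.1 hv).2.symm

theorem openCell_nonempty {t : Finset V} (ht : t.Nonempty) : (openCell t).Nonempty := by
  classical
  have hpos : (0 : ℝ) < t.card := by exact_mod_cast ht.card_pos
  refine ⟨fun v => if v ∈ t then (t.card : ℝ)⁻¹ else 0, ⟨fun v => ?_, fun v hv => if_neg hv, ?_⟩,
    fun v hv => ?_⟩
  · dsimp only
    split_ifs <;> positivity
  · rw [Finset.sum_congr rfl fun v hv => if_pos hv, Finset.sum_const, nsmul_eq_mul,
      mul_inv_cancel₀ hpos.ne']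
  · simp only [if_pos hv]
    positivity

theorem convex_cell (s : Finset V) : Convex ℝ (cell s) := by
  intro x hx y hy a b ha hb hab
  refine ⟨fun v => ?_, fun v hv => ?_, ?_⟩
  · have := hx.1 v
    have := hy.1 v
    simp only [Pi.add_apply, Pi.smul_apply, smul_eq_mul]
    positivity
  · simp [hx.2.1 v hv, hy.2.1 v hv]
  · simp only [Pi.add_apply, Pi.smul_apply, smul_eq_mul, Finset.sum_add_distrib,
      ← Finset.mul_sum, hx.2.2, hy.2.2, mul_one, hab]

theorem isClosed_cell (s : Finset V) : IsClosed (cell s) := by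
  have : cell s = (⋂ v, {x : V → ℝ | 0 ≤ x v}) ∩ ((⋂ v, ⋂ (_ : v ∉ s), {x : V → ℝ | x v = 0}) ∩
      {x | ∑ v ∈ s, x v = 1}) := by
    ext x
    simp [cell]
  rw [this]
  refine (isClosed_iInter fun v => isClosed_le continuous_const (continuous_apply v)).inter
    ((isClosed_iInter fun v => isClosed_iInter fun _ =>
      isClosed_eq (continuous_apply v) continuous_const).inter
    (isClosed_eq (by fun_prop) continuous_const))

end Cells

/-! ### Global topology: countably many vertices, and a top-dimensional simplex at every point -/

/-- A connected locally finite complex has countably many vertices: the points whose carrier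
meets the set of vertices reachable from a given one form a clopen set. -/
theorem countable_vertices [ConnectedSpace K.Space] : Countable V := by
  obtain ⟨⟨x₀, s₀, hs₀, hx₀⟩⟩ := (inferInstance : Nonempty K.Space)
  obtain ⟨v₀, hv₀⟩ := (K.isRelLowerSet_faces hs₀).1
  -- `S k` is the set of vertices that are reached from `v₀` in at most `k` steps.
  let S : ℕ → Set V := fun k => Nat.rec {v₀}
    (fun _ A => ⋃ v ∈ A, ⋃ s ∈ {s | s ∈ K.faces ∧ v ∈ s}, (s : Set V)) k
  have hS : ∀ k, (S k).Countable := by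
    intro k
    induction k with
    | zero => exact countable_singleton v₀
    | succ k ih =>
      exact ih.biUnion fun v _ => (K.locallyFinite v).countable.biUnion
        fun s _ => s.countable_toSet
  have hclosed : ∀ v ∈ ⋃ k, S k, ∀ s ∈ K.faces, v ∈ s → ∀ w ∈ s, w ∈ ⋃ k, S k := by
    intro v hv s hs hvs w hw
    obtain ⟨k, hk⟩ := mem_iUnion.1 hv
    refine mem_iUnion.2 ⟨k + 1, ?_⟩
    exact mem_biUnion hk (mem_biUnion (show s ∈ {s | s ∈ K.faces ∧ v ∈ s} from ⟨hs, hvs⟩) hw)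
  have hopen : ∀ T : Set V, IsOpen (⋃ v ∈ T, {x : K.Space | 0 < x.1 v}) := fun T =>
    isOpen_biUnion fun v _ => isOpen_lt continuous_const
      ((continuous_apply v).comp continuous_subtype_val)
  have hpt : ∀ v : V, ∃ x : K.Space, 0 < x.1 v ∧ ∀ w, 0 < x.1 w → w = v := by
    intro v
    obtain ⟨x, hx⟩ := openCell_nonempty (Finset.singleton_nonempty v)
    refine ⟨⟨x, {v}, K.singleton_mem v, hx.1⟩, hx.2 v (by simp), fun w hw => ?_⟩
    by_contra h
    exact hw.ne' (hx.1.2.1 w (by simpa using h))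
  have hall : ∀ w, w ∈ ⋃ k, S k := by
    by_contra! h
    obtain ⟨w, hw⟩ := h
    have hpre := (isPreconnected_univ (α := K.Space)) _ _ (hopen (⋃ k, S k))
      (hopen (⋃ k, S k)ᶜ) ?_ ?_ ?_
    · obtain ⟨y, -, hy1, hy2⟩ := hpre
      simp only [mem_iUnion₂, mem_ofPred_eq, exists_prop] at hy1 hy2
      obtain ⟨v, hv, hyv⟩ := hy1
      obtain ⟨u, hu, hyu⟩ := hy2
      obtain ⟨s, hs, hys⟩ := y.2
      refine hu (hclosed v hv s hs ?_ u ?_)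
      · by_contra h; exact hyv.ne' (hys.2.1 v h)
      · by_contra h; exact hyu.ne' (hys.2.1 u h)
    · intro y _
      obtain ⟨s, hs, hys⟩ := y.2
      obtain ⟨t, ht, hyt⟩ := K.exists_mem_openCell hs hys
      obtain ⟨v, hv⟩ := (K.isRelLowerSet_faces ht).1
      by_cases hvS : v ∈ ⋃ k, S k
      · exact Or.inl (mem_biUnion hvS (hyt.2 v hv))
      · exact Or.inr (mem_biUnion hvS (hyt.2 v hv))
    · obtain ⟨x, hx, -⟩ := hpt v₀
      exact ⟨x, mem_univ _, mem_biUnion (mem_iUnion.2 ⟨0, mem_singleton v₀⟩) hx⟩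
    · obtain ⟨x, hx, -⟩ := hpt w
      exact ⟨x, mem_univ _, mem_biUnion (show w ∈ (⋃ k, S k)ᶜ from hw) hx⟩
  have : (univ : Set V).Countable := (countable_iUnion hS).mono fun w _ => hall w
  exact countable_univ_iff.1 this

/-- The open star of the vertex set `t`: the points whose carrier contains `t`. -/
def openStar (t : Finset V) : Set K.Space := {x | ∀ v ∈ t, 0 < x.1 v}

theorem isOpen_openStar (t : Finset V) : IsOpen (K.openStar t) := by
  have : K.openStar t = ⋂ v ∈ t, {x : K.Space | 0 < x.1 v} := by
    ext x; simp [openStar]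
  rw [this]
  exact isOpen_biInter_finset fun v _ => isOpen_lt continuous_const
    ((continuous_apply v).comp continuous_subtype_val)

/-- The open star of a point in the interior of `t` is star-shaped about that point. -/
theorem isConnected_openStar {t : Finset V} (ht : t ∈ K.faces) {x : V → ℝ}
    (hx : x ∈ openCell t) : IsConnected (K.openStar t) := by
  have hxs : (⟨x, t, ht, hx.1⟩ : K.Space) ∈ K.openStar t := hx.2
  refine ⟨⟨_, hxs⟩, isPreconnected_of_forall ⟨x, t, ht, hx.1⟩ fun y hy => ?_⟩
  obtain ⟨s, hs, hys⟩ := y.2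
  have hxc : x ∈ cell s := cell_mono (subset_of_pos_of_mem_cell hy hys) hx.1
  let p : unitInterval → K.Space := fun τ => ⟨(1 - τ.1) • x + τ.1 • y.1, s, hs,
    convex_cell s hxc hys (by linarith [τ.2.2]) τ.2.1 (by ring)⟩
  have hp : Continuous p := by
    refine Continuous.subtype_mk ?_ _
    fun_prop
  refine ⟨range p, ?_, ⟨0, ?_⟩, ⟨1, ?_⟩, isPreconnected_range hp⟩
  · rintro _ ⟨τ, rfl⟩ v hv
    have h1 := hx.2 v hv
    have h2 : 0 < y.1 v := hy v hv
    have h3 := τ.2.1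
    have h4 : 0 ≤ 1 - τ.1 := by linarith [τ.2.2]
    simp only [p, Pi.add_apply, Pi.smul_apply, smul_eq_mul]
    rcases eq_or_lt_of_le h3 with h | h
    · rw [← h]; simpa using h1
    · have := mul_pos h h2
      have := mul_nonneg h4 h1.le
      linarith
  · apply Subtype.ext; simp [p]
  · apply Subtype.ext; simp [p]

theorem notMem_codimTwoSkeleton_iff {n : ℕ} {t : Finset V} (ht : t ∈ K.faces) {x : K.Space}
    (hx : x.1 ∈ openCell t) : x ∉ K.codimTwoSkeleton n ↔ n ≤ t.card := by
  constructor
  · intro h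
    by_contra hlt
    exact h ⟨t, ht, not_le.1 hlt, hx.1⟩
  · rintro h ⟨s, -, hsn, hxs⟩
    exact absurd (Finset.card_le_card (subset_of_pos_of_mem_cell hx.2 hxs)) (by omega)

variable {K} in
/-- The complement of the codimension-two skeleton is the disjoint union of two open pieces: the
open stars of the simplices of dimension at least `n - 1` that lie in an `n`-simplex, and of
those that do not. It is connected, so the second piece is empty. -/
theorem IsAdmissible.exists_superset {n : ℕ} (hK : K.IsAdmissible n) {t : Finset V}
    (ht : t ∈ K.faces) (hn : n ≤ t.card) : ∃ s ∈ K.faces, s.card = n + 1 ∧ t ⊆ s := by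
  obtain ⟨hconn, ⟨hdim, s₁, hs₁, hcard₁⟩, hadm⟩ := hK
  by_contra! hcon
  have hW := (hadm univ isOpen_univ isConnected_univ).2
  have hmem : ∀ {r : Finset V}, r ∈ K.faces → n ≤ r.card →
      ∃ y : K.Space, y ∈ univ \ K.codimTwoSkeleton n ∧ y ∈ K.openStar r := by
    intro r hr hnr
    obtain ⟨y, hy⟩ := openCell_nonempty (K.isRelLowerSet_faces hr).1
    exact ⟨⟨y, r, hr, hy.1⟩, ⟨mem_univ _, (K.notMem_codimTwoSkeleton_iff hr hy).2 hnr⟩, hy.2⟩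
  let F : Set (Finset V) := {r | r ∈ K.faces ∧ n ≤ r.card ∧ ∃ s ∈ K.faces, s.card = n + 1 ∧ r ⊆ s}
  let G : Set (Finset V) := {r | r ∈ K.faces ∧ n ≤ r.card ∧
    ∀ s ∈ K.faces, s.card = n + 1 → ¬ r ⊆ s}
  have hpre := hW (⋃ r ∈ F, K.openStar r) (⋃ r ∈ G, K.openStar r)
    (isOpen_biUnion fun r _ => K.isOpen_openStar r)
    (isOpen_biUnion fun r _ => K.isOpen_openStar r) ?_ ?_ ?_
  · obtain ⟨y, -, hyF, hyG⟩ := hpre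
    simp only [mem_iUnion₂, exists_prop] at hyF hyG
    obtain ⟨r, ⟨hr, hnr, s, hs, hsn, hrs⟩, hyr⟩ := hyF
    obtain ⟨q, ⟨hq, hnq, hqs⟩, hyq⟩ := hyG
    obtain ⟨u, hu, hyu⟩ := y.2
    obtain ⟨p, hp, hyp⟩ := K.exists_mem_openCell hu hyu
    have hrp : r ⊆ p := subset_of_pos_of_mem_cell hyr hyp.1
    have hqp : q ⊆ p := subset_of_pos_of_mem_cell hyq hyp.1
    have hpn : p.card ≤ n := by
      have h1 := hdim p hp
      have h2 : p.card ≠ n + 1 := fun h => hqs p hp h hqp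
      omega
    have h1 : q = p := Finset.eq_of_subset_of_card_le hqp (by omega)
    have h2 : r = p := Finset.eq_of_subset_of_card_le hrp (by omega)
    exact hqs s hs hsn (h1 ▸ h2 ▸ hrs)
  · rintro y ⟨-, hy⟩
    obtain ⟨u, hu, hyu⟩ := y.2
    obtain ⟨p, hp, hyp⟩ := K.exists_mem_openCell hu hyu
    have hpn := (K.notMem_codimTwoSkeleton_iff hp hyp).1 hy
    by_cases h : ∃ s ∈ K.faces, s.card = n + 1 ∧ p ⊆ s
    · exact Or.inl (mem_biUnion (show p ∈ F from ⟨hp, hpn, h⟩) hyp.2)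
    · push Not at h
      exact Or.inr (mem_biUnion (show p ∈ G from ⟨hp, hpn, h⟩) hyp.2)
  · obtain ⟨y, hy, hys⟩ := hmem hs₁ (by omega)
    exact ⟨y, hy, mem_biUnion (show s₁ ∈ F from ⟨hs₁, by omega, s₁, hs₁, hcard₁, subset_rfl⟩) hys⟩
  · obtain ⟨y, hy, hys⟩ := hmem ht hn
    exact ⟨y, hy, mem_biUnion (show t ∈ G from ⟨ht, hn, hcon⟩) hys⟩

variable {K} in
/-- The open star of the carrier of `x` is connected, so it meets the complement of the
codimension-two skeleton, whose points lie in `n`-simplices. -/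
theorem IsAdmissible.exists_mem_cell {n : ℕ} (hK : K.IsAdmissible n) (x : K.Space) :
    ∃ s ∈ K.faces, s.card = n + 1 ∧ x.1 ∈ cell s := by
  obtain ⟨u, hu, hxu⟩ := x.2
  obtain ⟨t, ht, hxt⟩ := K.exists_mem_openCell hu hxu
  obtain ⟨y, hyt, hy⟩ := (hK.2.2 _ (K.isOpen_openStar t) (K.isConnected_openStar ht hxt)).1
  obtain ⟨w, hw, hyw⟩ := y.2
  obtain ⟨p, hp, hyp⟩ := K.exists_mem_openCell hw hyw
  obtain ⟨s, hs, hsn, hps⟩ := hK.exists_superset hp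
    ((K.notMem_codimTwoSkeleton_iff hp hyp).1 hy)
  exact ⟨s, hs, hsn, cell_mono ((subset_of_pos_of_mem_cell hyt hyp.1).trans hps) hxt.1⟩

/-! ### The Riemannian metric on a simplex -/

section Metric

theorem inner_add_right (s : Finset V) (x u w w' : V → ℝ) :
    K.inner s x u (w + w') = K.inner s x u w + K.inner s x u w' :=
  map_add (K.metric s (s.restrict x) (s.restrict u)) (s.restrict w) (s.restrict w')

theorem inner_smul_right (s : Finset V) (x u w : V → ℝ) (a : ℝ) :
    K.inner s x u (a • w) = a * K.inner s x u w :=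
  map_smul (K.metric s (s.restrict x) (s.restrict u)) a (s.restrict w)

theorem inner_smul_left (s : Finset V) (x u w : V → ℝ) (a : ℝ) :
    K.inner s x (a • u) w = a * K.inner s x u w := by
  have := map_smul (K.metric s (s.restrict x)) a (s.restrict u)
  exact congrArg (fun f => f (s.restrict w)) this

theorem inner_sum_right {ι : Type*} [Fintype ι] (s : Finset V) (x u : V → ℝ) (c : ι → ℝ)
    (e : ι → V → ℝ) :
    K.inner s x u (∑ i, c i • e i) = ∑ i, c i * K.inner s x u (e i) := by
  let f : (V → ℝ) →ₗ[ℝ] ℝ :=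
    { toFun := K.inner s x u
      map_add' := K.inner_add_right s x u
      map_smul' := fun a w => K.inner_smul_right s x u w a }
  have := map_sum f (fun i => c i • e i) Finset.univ
  simp only [map_smul, smul_eq_mul] at this
  exact this

theorem inner_sum_left {ι : Type*} [Fintype ι] (s : Finset V) (x w : V → ℝ) (c : ι → ℝ)
    (e : ι → V → ℝ) :
    K.inner s x (∑ i, c i • e i) w = ∑ i, c i * K.inner s x (e i) w := by
  let f : (V → ℝ) →ₗ[ℝ] ℝ :=
    { toFun := fun u => K.inner s x u w
      map_add' := fun u u' => by
        have := map_add (K.metric s (s.restrict x)) (s.restrict u) (s.restrict u')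
        exact congrArg (fun f => f (s.restrict w)) this
      map_smul' := fun a u => K.inner_smul_left s x u w a }
  have := map_sum f (fun i => c i • e i) Finset.univ
  simp only [map_smul, smul_eq_mul] at this
  exact this

variable {K} in
theorem continuous_inner {s : Finset V} (hs : s ∈ K.faces) {α : Type*} [TopologicalSpace α]
    {x u w : α → V → ℝ} (hx : Continuous x) (hu : Continuous u) (hw : Continuous w) :
    Continuous fun a => K.inner s (x a) (u a) (w a) := by
  have hr : ∀ {f : α → V → ℝ}, Continuous f → Continuous fun a => s.restrict (f a) := fun hf =>
    continuous_pi fun i => (continuous_apply (i : V)).comp hf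
  exact (((K.smooth s hs).continuous.comp (hr hx)).clm_apply (hr hu)).clm_apply (hr hw)

end Metric

section EdgeCoordinates

open scoped Classical in
/-- The tangent vector of the simplex `s` with coordinates `c` in the basis of the edge vectors
from the vertex `o`. -/
def edgeSum (s : Finset V) (o : V) (c : s.erase o → ℝ) : V → ℝ := ∑ i, c i • edge s o i

open scoped Classical in
theorem edgeSum_apply (s : Finset V) (o : V) (c : s.erase o → ℝ) (v : V) :
    edgeSum s o c v = (∑ i : s.erase o, if (i : V) = v then c i else 0) -
      if v = o then ∑ i, c i else 0 := by
  simp only [edgeSum, edge, Finset.sum_apply, Pi.smul_apply, Pi.sub_apply, Pi.single_apply,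
    smul_eq_mul, mul_sub, Finset.sum_sub_distrib]
  congr 1
  · exact Finset.sum_congr rfl fun i _ => by simp [eq_comm]
  · split_ifs <;> simp

open scoped Classical in
theorem edgeSum_apply_of_mem {s : Finset V} {o : V} (c : s.erase o → ℝ) (i : s.erase o) :
    edgeSum s o c i = c i := by
  rw [edgeSum_apply, if_neg (Finset.ne_of_mem_erase i.2), sub_zero]
  simp only [Subtype.coe_inj]
  simp

open scoped Classical in
theorem edgeSum_smul (s : Finset V) (o : V) (a : ℝ) (c : s.erase o → ℝ) :
    edgeSum s o (a • c) = a • edgeSum s o c := by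
  simp [edgeSum, Finset.smul_sum, smul_smul]

open scoped Classical in
theorem continuous_edgeSum (s : Finset V) (o : V) : Continuous (edgeSum s o) := by
  unfold edgeSum
  fun_prop

open scoped Classical in
theorem edgeSum_mem_cellTangent {s : Finset V} {o : V} (ho : o ∈ s) (c : s.erase o → ℝ) :
    edgeSum s o c ∈ cellTangent s := by
  constructor
  · intro v hv
    rw [edgeSum_apply, if_neg fun h : v = o => hv (h ▸ ho), sub_zero]
    refine Finset.sum_eq_zero fun i _ => if_neg fun h : (i : V) = v =>
      hv (h ▸ Finset.mem_of_mem_erase i.2)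
  · simp only [edgeSum_apply, Finset.sum_sub_distrib]
    rw [Finset.sum_comm, Finset.sum_ite_eq' s o, if_pos ho, sub_eq_zero]
    refine Finset.sum_congr rfl fun i _ => ?_
    rw [Finset.sum_ite_eq s (i : V), if_pos (Finset.mem_of_mem_erase i.2)]

open scoped Classical in
theorem edgeSum_ne_zero {s : Finset V} {o : V} {c : s.erase o → ℝ} (hc : c ≠ 0) :
    edgeSum s o c ≠ 0 := by
  contrapose! hc
  ext i
  rw [← edgeSum_apply_of_mem c i, hc]
  rfl

open scoped Classical in
theorem exists_edgeSum_eq {s : Finset V} {o : V} (ho : o ∈ s) {u : V → ℝ}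
    (hu : u ∈ cellTangent s) : ∃ c, edgeSum s o c = u := by
  refine ⟨fun i => u i, ?_⟩
  have h1 := edgeSum_mem_cellTangent ho fun i : s.erase o => u i
  have h2 : ∀ v ∈ s.erase o, edgeSum s o (fun i : s.erase o => u i) v = u v := fun v hv =>
    edgeSum_apply_of_mem (fun i : s.erase o => u i) ⟨v, hv⟩
  ext v
  by_cases hv : v ∈ s
  · by_cases hvo : v = o
    · have h3 := h1.2
      have h4 := hu.2
      rw [← Finset.add_sum_erase s _ ho, Finset.sum_congr rfl h2] at h3
      rw [← Finset.add_sum_erase s _ ho] at h4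
      rw [hvo]
      linarith
    · exact h2 v (Finset.mem_erase.2 ⟨hvo, hv⟩)
  · rw [h1.1 v hv, hu.1 v hv]

end EdgeCoordinates

/-! ### The spherical volume of a sector -/

section Sector

theorem smul_mem_cellCone {s : Finset V} {x u : V → ℝ} (hu : u ∈ cellCone s x) {a : ℝ}
    (ha : 0 ≤ a) : a • u ∈ cellCone s x := by
  refine ⟨⟨fun v hv => ?_, ?_⟩, fun v hv hx => ?_⟩
  · simp [hu.1.1 v hv]
  · simp only [Pi.smul_apply, smul_eq_mul, ← Finset.mul_sum, hu.1.2, mul_zero]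
  · exact mul_nonneg ha (hu.2 v hv hx)

theorem measurableSet_cellCone [Countable V] (s : Finset V) :
    MeasurableSet {p : (V → ℝ) × (V → ℝ) | p.2 ∈ cellCone s p.1} := by
  have : {p : (V → ℝ) × (V → ℝ) | p.2 ∈ cellCone s p.1} =
      ((⋂ v, ⋂ (_ : v ∉ s), {p | p.2 v = 0}) ∩ {p | ∑ v ∈ s, p.2 v = 0}) ∩
        ⋂ v ∈ s, ({p | p.1 v = 0}ᶜ ∪ {p | 0 ≤ p.2 v}) := by
    ext p
    simp [cellCone, cellTangent, imp_iff_not_or]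
  rw [this]
  refine ((MeasurableSet.iInter fun v => MeasurableSet.iInter fun _ =>
    measurableSet_eq_fun (by fun_prop) measurable_const).inter
    (measurableSet_eq_fun (by fun_prop) measurable_const)).inter
    (Finset.measurableSet_biInter _ fun v _ =>
      (measurableSet_eq_fun (by fun_prop) measurable_const).compl.union
        (measurableSet_le measurable_const (by fun_prop)))

theorem measurableSet_linkSpace [Countable V] :
    MeasurableSet {z : (V → ℝ) × (V → ℝ) |
      ∃ s ∈ K.faces, z.1 ∈ cell s ∧ z.2 ∈ cellCone s z.1 ∧ K.inner s z.1 z.2 z.2 = 1} := by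
  have : {z : (V → ℝ) × (V → ℝ) |
      ∃ s ∈ K.faces, z.1 ∈ cell s ∧ z.2 ∈ cellCone s z.1 ∧ K.inner s z.1 z.2 z.2 = 1} =
      ⋃ s ∈ K.faces, (Prod.fst ⁻¹' cell s ∩ ({z | z.2 ∈ cellCone s z.1} ∩
        {z | K.inner s z.1 z.2 z.2 = 1})) := by
    ext z
    simp only [mem_ofPred_eq, mem_iUnion₂, mem_inter_iff, mem_preimage, exists_prop]
  rw [this]
  refine MeasurableSet.biUnion (to_countable _) fun s hs => ?_
  exact (measurable_fst (isClosed_cell s).measurableSet).inter ((measurableSet_cellCone s).inter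
    (isClosed_eq (continuous_inner hs continuous_fst continuous_snd continuous_snd)
      continuous_const).measurableSet)

open scoped Classical in
/-- The coordinates of the vectors in the sector of the unit ball whose volume defines the
spherical volume. -/
def sector (s : Finset V) (o : V) : Set ((V → ℝ) × (s.erase o → ℝ)) :=
  {p | edgeSum s o p.2 ∈ cellCone s p.1 ∧
    0 < K.inner s p.1 (edgeSum s o p.2) (edgeSum s o p.2) ∧
    K.inner s p.1 (edgeSum s o p.2) (edgeSum s o p.2) ≤ 1}

open scoped Classical in
/-- The unit vector in the direction with given coordinates. -/
def unitDirection (s : Finset V) (o : V) (x : V → ℝ) (c : s.erase o → ℝ) : V → ℝ :=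
  (Real.sqrt (K.inner s x (edgeSum s o c) (edgeSum s o c)))⁻¹ • edgeSum s o c

variable {K}

open scoped Classical in
theorem continuous_inner_edgeSum {s : Finset V} (hs : s ∈ K.faces) (o : V) :
    Continuous fun p : (V → ℝ) × (s.erase o → ℝ) =>
      K.inner s p.1 (edgeSum s o p.2) (edgeSum s o p.2) :=
  continuous_inner hs continuous_fst ((continuous_edgeSum s o).comp continuous_snd)
    ((continuous_edgeSum s o).comp continuous_snd)

open scoped Classical in
theorem measurable_unitDirection [Countable V] {s : Finset V} (hs : s ∈ K.faces) (o : V) :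
    Measurable fun p : (V → ℝ) × (s.erase o → ℝ) => K.unitDirection s o p.1 p.2 := by
  refine measurable_pi_iff.2 fun v => ?_
  have h1 := (continuous_inner_edgeSum hs o).measurable
  have h2 : Measurable fun p : (V → ℝ) × (s.erase o → ℝ) => edgeSum s o p.2 v :=
    (((continuous_apply v).comp (continuous_edgeSum s o)).measurable).comp measurable_snd
  exact h1.sqrt.inv.mul h2

open scoped Classical in
theorem measurableSet_sector [Countable V] {s : Finset V} (hs : s ∈ K.faces) (o : V) :
    MeasurableSet (K.sector s o) := by
  have h := (continuous_inner_edgeSum hs o).measurable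
  have h2 : Measurable fun p : (V → ℝ) × (s.erase o → ℝ) => (p.1, edgeSum s o p.2) :=
    measurable_fst.prodMk ((continuous_edgeSum s o).measurable.comp measurable_snd)
  exact (h2 (measurableSet_cellCone s)).inter
    ((measurableSet_lt measurable_const h).inter (measurableSet_le h measurable_const))

open scoped Classical in
theorem sectorVolume_apply [Countable V] {s : Finset V} (hs : s ∈ K.faces) (o : V) (x : V → ℝ)
    {A : Set (V → ℝ)} (hA : MeasurableSet A) :
    K.sectorVolume s o x A = ENNReal.ofReal (K.volumeDensity s o x) *
      volume {c | K.unitDirection s o x c ∈ A ∧ (x, c) ∈ K.sector s o} := by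
  have hm : Measurable (K.unitDirection s o x) :=
    (measurable_unitDirection hs o).comp measurable_prodMk_left
  rw [sectorVolume, Measure.smul_apply, smul_eq_mul]
  congr 1
  have := Measure.map_apply (μ := volume.restrict {c | (x, c) ∈ K.sector s o}) hm hA
  rw [Measure.restrict_apply (hm hA)] at this
  exact this

open scoped Classical in
theorem measurable_sectorVolume [Countable V] {s : Finset V} (hs : s ∈ K.faces) (o : V)
    {S : Set ((V → ℝ) × (V → ℝ))} (hS : MeasurableSet S) :
    Measurable fun x => K.sectorVolume s o x (Prod.mk x ⁻¹' S) := by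
  simp_rw [fun x => sectorVolume_apply hs o x (measurable_prodMk_left (x := x) hS)]
  refine Measurable.mul ?_ ?_
  · refine ENNReal.measurable_ofReal.comp (Continuous.measurable ?_)
    refine Real.continuous_sqrt.comp (Continuous.matrix_det ?_)
    refine continuous_matrix fun i j => ?_
    exact continuous_inner hs continuous_id continuous_const continuous_const
  · have hm : Measurable fun p : (V → ℝ) × (s.erase o → ℝ) =>
        (p.1, K.unitDirection s o p.1 p.2) :=
      measurable_fst.prodMk (measurable_unitDirection hs o)
    exact measurable_measure_prodMk_left
      (s := (fun p : (V → ℝ) × (s.erase o → ℝ) => (p.1, K.unitDirection s o p.1 p.2)) ⁻¹' S ∩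
        K.sector s o) ((hm hS).inter (measurableSet_sector hs o))

/-- The spherical volume of the simplex `s` at `x` is carried by the unit vectors at `x` that
point into `s`. -/
theorem sectorVolume_eq_zero [Countable V] {s : Finset V} (hs : s ∈ K.faces) (o : V)
    (x : V → ℝ) {A : Set (V → ℝ)} (hA : MeasurableSet A)
    (h : ∀ u ∈ A, u ∈ cellCone s x → K.inner s x u u ≠ 1) : K.sectorVolume s o x A = 0 := by
  classical
  rw [sectorVolume_apply hs o x hA]
  convert mul_zero _
  convert measure_empty (μ := volume)
  rw [Set.eq_empty_iff_forall_notMem]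
  rintro c ⟨hcA, hcone, hpos, -⟩
  refine h _ hcA (smul_mem_cellCone hcone (by positivity)) ?_
  have hne := (Real.sqrt_pos.2 hpos).ne'
  rw [unitDirection, inner_smul_left, inner_smul_right, ← mul_assoc, ← mul_inv,
    Real.mul_self_sqrt hpos.le, inv_mul_cancel₀ hpos.ne']

open scoped Classical in
theorem inner_edgeSum_pos {s : Finset V} (hs : s ∈ K.faces) {o : V} (ho : o ∈ s) {x : V → ℝ}
    (hx : x ∈ cell s) {c : s.erase o → ℝ} (hc : c ≠ 0) :
    0 < K.inner s x (edgeSum s o c) (edgeSum s o c) :=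
  K.pos s hs x hx _ (edgeSum_mem_cellTangent ho c) (edgeSum_ne_zero hc)

open scoped Classical in
theorem inner_edgeSum_smul (s : Finset V) (o : V) (x : V → ℝ) (a : ℝ) (c : s.erase o → ℝ) :
    K.inner s x (edgeSum s o (a • c)) (edgeSum s o (a • c)) =
      a ^ 2 * K.inner s x (edgeSum s o c) (edgeSum s o c) := by
  rw [edgeSum_smul, inner_smul_left, inner_smul_right]
  ring

open scoped Classical in
theorem edge_mem_cellTangent {s : Finset V} {o : V} (ho : o ∈ s) (i : s.erase o) :
    edge s o i ∈ cellTangent s := by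
  have := edgeSum_mem_cellTangent ho (Pi.single i 1)
  rwa [edgeSum, Finset.sum_eq_single i (fun j _ hj => by simp [hj]) (by simp), Pi.single_eq_same,
    one_smul] at this

theorem volumeDensity_pos {s : Finset V} (hs : s ∈ K.faces) {o : V} (ho : o ∈ s) {x : V → ℝ}
    (hx : x ∈ cell s) : 0 < K.volumeDensity s o x := by
  classical
  refine Real.sqrt_pos.2 (Matrix.PosDef.det_pos (Matrix.PosDef.of_dotProduct_mulVec_pos ?_ ?_))
  · ext i j
    exact K.symm s hs x hx _ (edge_mem_cellTangent ho j) _ (edge_mem_cellTangent ho i)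
  · intro c hc
    have := inner_edgeSum_pos hs ho hx hc
    rw [edgeSum, inner_sum_left] at this
    simp_rw [inner_sum_right] at this
    simp only [dotProduct, Matrix.mulVec, Matrix.of_apply, star_trivial]
    simp only [edge, mul_comm (K.inner s x _ _)] at this ⊢
    exact this

open scoped Classical in
/-- A positive definite quadratic form has a bounded unit ball. -/
theorem sectorVolume_univ_lt_top [Countable V] {s : Finset V} (hs : s ∈ K.faces) {o : V}
    (ho : o ∈ s) {x : V → ℝ} (hx : x ∈ cell s) : K.sectorVolume s o x univ < ∞ := by
  rw [sectorVolume_apply hs o x MeasurableSet.univ]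
  refine ENNReal.mul_lt_top ENNReal.ofReal_lt_top ?_
  have hcont : Continuous fun c : s.erase o → ℝ =>
      K.inner s x (edgeSum s o c) (edgeSum s o c) :=
    (continuous_inner_edgeSum hs o).comp (Continuous.prodMk_right x)
  obtain ⟨m, hm, hmin⟩ := (isCompact_sphere (0 : s.erase o → ℝ) 1).exists_forall_le'
    hcont.continuousOn (a := 0) fun c hc =>
      inner_edgeSum_pos hs ho hx (ne_zero_of_mem_unit_sphere ⟨c, hc⟩)
  refine (measure_mono ?_).trans_lt
    (measure_closedBall_lt_top (x := (0 : s.erase o → ℝ)) (r := Real.sqrt m⁻¹))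
  rintro c ⟨-, -, hpos, hle⟩
  have hc0 : c ≠ 0 := by
    rintro rfl
    rw [← zero_smul ℝ (0 : s.erase o → ℝ), inner_edgeSum_smul] at hpos
    simp at hpos
  have hn : 0 < ‖c‖ := norm_pos_iff.2 hc0
  have h1 := hmin (‖c‖⁻¹ • c) (by simp [norm_smul, hn.ne'])
  simp only [inner_edgeSum_smul] at h1
  rw [mem_closedBall_zero_iff]
  refine Real.le_sqrt_of_sq_le ?_
  rw [le_inv_comm₀ (by positivity) hm, ← inv_pow]
  refine h1.trans ?_
  exact mul_le_of_le_one_right (by positivity) hle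

open scoped Classical in
/-- The sector has a nonempty interior, near a small multiple of a vector from `x` to an interior
point of the simplex. -/
theorem sectorVolume_univ_pos [Countable V] {s : Finset V} (hs : s ∈ K.faces) {o : V}
    (ho : o ∈ s) (hcard : 2 ≤ s.card) {x : V → ℝ} (hx : x ∈ cell s) :
    0 < K.sectorVolume s o x univ := by
  rw [sectorVolume_apply hs o x MeasurableSet.univ]
  refine ENNReal.mul_pos (ENNReal.ofReal_pos.2 (volumeDensity_pos hs ho hx)).ne' ?_
  have hcont : Continuous fun c : s.erase o → ℝ =>
      K.inner s x (edgeSum s o c) (edgeSum s o c) :=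
    (continuous_inner_edgeSum hs o).comp (Continuous.prodMk_right x)
  have hne : Nonempty (s.erase o) := by
    refine Finset.Nonempty.to_subtype (Finset.card_pos.1 ?_)
    rw [Finset.card_erase_of_mem ho]
    omega
  -- The directions pointing into the interior of `s`, of length less than one.
  let U : Set (s.erase o → ℝ) := (⋂ v ∈ s, {c | x v = 0 → 0 < edgeSum s o c v}) ∩
    {c | K.inner s x (edgeSum s o c) (edgeSum s o c) < 1}
  have hU : IsOpen U := by
    refine (isOpen_biInter_finset fun v _ => ?_).inter (isOpen_lt hcont continuous_const)
    by_cases h : x v = 0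
    · simp only [h, forall_const]
      exact isOpen_lt continuous_const ((continuous_apply v).comp (continuous_edgeSum s o))
    · simp [h]
  have hUne : U.Nonempty := by
    obtain ⟨y, hy⟩ := openCell_nonempty ⟨o, ho⟩
    have hyx : y - x ∈ cellTangent s := by
      refine ⟨fun v hv => ?_, ?_⟩
      · simp [hx.2.1 v hv, hy.1.2.1 v hv]
      · simp [hx.2.2, hy.1.2.2]
    obtain ⟨c, hc⟩ := exists_edgeSum_eq ho hyx
    have hlim : Tendsto (fun a : ℝ =>
        a ^ 2 * K.inner s x (edgeSum s o c) (edgeSum s o c)) (𝓝[>] 0) (𝓝 0) := by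
      have : Continuous fun a : ℝ => a ^ 2 * K.inner s x (edgeSum s o c) (edgeSum s o c) := by
        fun_prop
      have h := this.tendsto 0
      simp only [ne_eq, OfNat.ofNat_ne_zero, not_false_eq_true, zero_pow, zero_mul] at h
      exact h.mono_left nhdsWithin_le_nhds
    obtain ⟨a, ha, ha0⟩ := ((hlim.eventually (gt_mem_nhds zero_lt_one)).and
      self_mem_nhdsWithin).exists
    refine ⟨a • c, mem_iInter₂.2 fun v hv hxv => ?_, ?_⟩
    · rw [edgeSum_smul, hc]
      simp only [Pi.smul_apply, Pi.sub_apply, hxv, sub_zero, smul_eq_mul]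
      exact mul_pos ha0 (hy.2 v hv)
    · simpa only [mem_ofPred_eq, inner_edgeSum_smul] using ha
  have hpos : volume (U \ {0}) ≠ 0 := by
    rw [measure_sdiff_null (measure_singleton _)]
    exact (hU.measure_pos volume hUne).ne'
  refine fun h0 => hpos (measure_mono_null ?_ h0)
  rintro c ⟨⟨hc1, hc2⟩, hc0⟩
  refine ⟨mem_univ _, ⟨edgeSum_mem_cellTangent ho c, fun v hv hxv => ?_⟩,
    inner_edgeSum_pos hs ho hx hc0, (mem_ofPred_eq ▸ hc2).le⟩
  exact (mem_iInter₂.1 hc1 v hv hxv).le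

end Sector

variable {K}

/-! ### The uniform measure on the link as a Markov kernel -/

section LinkKernel

theorem measurable_linkVolume [Countable V] (n : ℕ) {S : Set ((V → ℝ) × (V → ℝ))}
    (hS : MeasurableSet S) : Measurable fun x => K.linkVolume n x (Prod.mk x ⁻¹' S) := by
  classical
  -- The sum over the simplices that contain `x` becomes a sum over all `n`-simplices.
  have h : (fun x => K.linkVolume n x (Prod.mk x ⁻¹' S)) = fun x =>
      ∑' s : {s : Finset V // s ∈ K.faces ∧ s.card = n + 1},
        (cell s.1).indicator (fun x => K.sectorVolume s.1
          (K.isRelLowerSet_faces s.2.1).1.choose x (Prod.mk x ⁻¹' S)) x := by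
    ext x
    rw [linkVolume, Measure.sum_apply _ (measurable_prodMk_left hS)]
    let f : {s : Finset V // s ∈ K.faces ∧ s.card = n + 1 ∧ x ∈ cell s} →
        {s : Finset V // s ∈ K.faces ∧ s.card = n + 1} := fun s => ⟨s.1, s.2.1, s.2.2.1⟩
    have hf : Function.Injective f := fun s t h => Subtype.ext (congrArg (fun r => r.1) h)
    rw [← hf.tsum_eq]
    · refine tsum_congr fun s => ?_
      exact ((cell s.1).indicator_of_mem s.2.2.2 (fun x => K.sectorVolume s.1
        (K.isRelLowerSet_faces s.2.1).1.choose x (Prod.mk x ⁻¹' S))).symm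
    · intro s hs
      have hx : x ∈ cell s.1 := by
        by_contra hx
        refine hs ?_
        exact Set.indicator_of_notMem (s := cell s.1) hx _
      exact ⟨⟨s.1, s.2.1, s.2.2, hx⟩, rfl⟩
  rw [h]
  exact Measurable.tsum fun s =>
    (measurable_sectorVolume s.2.1 _ hS).indicator (isClosed_cell s.1).measurableSet

theorem linkVolume_univ_lt_top [Countable V] (n : ℕ) (x : K.Space) :
    K.linkVolume n x.1 univ < ∞ := by
  obtain ⟨s, hs, hxs⟩ := x.2
  obtain ⟨t, ht, hxt⟩ := K.exists_mem_openCell hs hxs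
  obtain ⟨v, hv⟩ := (K.isRelLowerSet_faces ht).1
  have hfin : {s : Finset V | s ∈ K.faces ∧ s.card = n + 1 ∧ x.1 ∈ cell s}.Finite :=
    (K.locallyFinite v).subset fun s hs =>
      ⟨hs.1, subset_of_pos_of_mem_cell hxt.2 hs.2.2 hv⟩
  have : Finite {s : Finset V // s ∈ K.faces ∧ s.card = n + 1 ∧ x.1 ∈ cell s} := hfin
  have := Fintype.ofFinite {s : Finset V // s ∈ K.faces ∧ s.card = n + 1 ∧ x.1 ∈ cell s}
  rw [linkVolume, Measure.sum_apply _ MeasurableSet.univ, tsum_fintype]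
  exact ENNReal.sum_lt_top.2 fun s _ =>
    sectorVolume_univ_lt_top s.2.1 (K.isRelLowerSet_faces s.2.1).1.choose_spec s.2.2.2

theorem linkVolume_univ_pos [Countable V] {n : ℕ} (hn : 1 ≤ n) (hK : K.IsAdmissible n)
    (x : K.Space) : 0 < K.linkVolume n x.1 univ := by
  obtain ⟨s, hs, hsn, hxs⟩ := hK.exists_mem_cell x
  refine (sectorVolume_univ_pos hs (K.isRelLowerSet_faces hs).1.choose_spec (by omega) hxs).trans_le
    ?_
  exact Measure.le_sum (fun s : {s : Finset V // s ∈ K.faces ∧ s.card = n + 1 ∧ x.1 ∈ cell s} =>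
    K.sectorVolume s.1 (K.isRelLowerSet_faces s.2.1).1.choose x.1) ⟨s, hs, hsn, hxs⟩ univ

theorem uniformLink_apply [Countable V] (n : ℕ) (x : K.Space) {B : Set K.LinkSpace}
    (hB : MeasurableSet B) : K.uniformLink n x B =
      (K.linkVolume n x.1 univ)⁻¹ * K.linkVolume n x.1 (Prod.mk x.1 ⁻¹' (Subtype.val '' B)) := by
  have he := MeasurableEmbedding.subtype_coe K.measurableSet_linkSpace
  rw [uniformLink]
  erw [he.comap_apply, Measure.map_apply measurable_prodMk_left (he.measurableSet_image.2 hB),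
    Measure.smul_apply]
  rfl

/-- The uniform measure on the link of `x`, as a kernel. -/
def linkKernel (K : RiemannianComplex V) [Countable V] (n : ℕ) :
    ProbabilityTheory.Kernel K.Space K.LinkSpace where
  toFun := K.uniformLink n
  measurable' := by
    refine Measure.measurable_of_measurable_coe _ fun B hB => ?_
    simp_rw [fun x => uniformLink_apply n x hB]
    have he := MeasurableEmbedding.subtype_coe K.measurableSet_linkSpace
    have hc : Measurable fun x : K.Space => x.1 := measurable_subtype_coe
    have h1 := (measurable_linkVolume (K := K) n MeasurableSet.univ).comp hc
    have h2 := (measurable_linkVolume (K := K) n (he.measurableSet_image.2 hB)).comp hc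
    exact h1.inv.mul h2

theorem linkKernel_apply [Countable V] (n : ℕ) (x : K.Space) :
    K.linkKernel n x = K.uniformLink n x := rfl

theorem isProbabilityMeasure_uniformLink [Countable V] {n : ℕ} (hn : 1 ≤ n)
    (hK : K.IsAdmissible n) (x : K.Space) : IsProbabilityMeasure (K.uniformLink n x) := by
  have he := MeasurableEmbedding.subtype_coe K.measurableSet_linkSpace
  constructor
  rw [uniformLink_apply n x MeasurableSet.univ]
  have hM : MeasurableSet (Prod.mk x.1 ⁻¹' (Subtype.val '' (univ : Set K.LinkSpace))) :=
    measurable_prodMk_left (he.measurableSet_image.2 MeasurableSet.univ)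
  have h0 : K.linkVolume n x.1
      (Prod.mk x.1 ⁻¹' (Subtype.val '' (univ : Set K.LinkSpace)))ᶜ = 0 := by
    rw [linkVolume, Measure.sum_apply _ hM.compl, ENNReal.tsum_eq_zero]
    intro s
    refine sectorVolume_eq_zero s.2.1 _ _ hM.compl fun u hu hcone hone => hu ?_
    exact ⟨⟨(x.1, u), s.1, s.2.1, s.2.2.2, hcone, hone⟩, mem_univ _, rfl⟩
  rw [measure_of_measure_compl_eq_zero h0]
  exact ENNReal.inv_mul_cancel (linkVolume_univ_pos hn hK x).ne' (linkVolume_univ_lt_top n x).ne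

theorem isMarkovKernel_linkKernel [Countable V] {n : ℕ} (hn : 1 ≤ n) (hK : K.IsAdmissible n) :
    ProbabilityTheory.IsMarkovKernel (K.linkKernel n) :=
  ⟨isProbabilityMeasure_uniformLink hn hK⟩

theorem measurable_base : Measurable K.base :=
  (measurable_fst.comp measurable_subtype_coe).subtype_mk

instance [Countable V] : SecondCountableTopology K.Space :=
  Topology.IsInducing.subtypeVal.secondCountableTopology

instance [Countable V] : TopologicalSpace.MetrizableSpace K.Space :=
  Topology.IsEmbedding.subtypeVal.metrizableSpace

theorem ae_base_uniformLink [Countable V] (n : ℕ) (x : K.Space) :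
    ∀ᵐ z ∂K.uniformLink n x, K.base z = x := by
  rw [ae_iff]
  have hm : MeasurableSet {z : K.LinkSpace | ¬ K.base z = x} :=
    (measurableSet_eq_fun measurable_base measurable_const).compl
  rw [uniformLink_apply n x hm]
  convert mul_zero _
  convert measure_empty (μ := K.linkVolume n x.1)
  rw [Set.eq_empty_iff_forall_notMem]
  rintro u ⟨z, hz, hzu⟩
  exact hz (Subtype.ext (congrArg Prod.fst hzu))

end LinkKernel

open ProbabilityTheory

/-! ### The chain of positions, directions and times -/

section Chain

theorem IsGeodesicFlow.measurable_uncurry [Countable V] {n : ℕ}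
    {X : K.LinkSpace → ℝ≥0 → K.Space} (hX : K.IsGeodesicFlow n X) :
    Measurable fun q : K.LinkSpace × ℝ≥0 => X q.1 q.2 :=
  (measurable_uncurry_of_continuous_of_measurable (u := fun t z => X z t) hX.continuous
    hX.measurable).comp measurable_swap

variable [Countable V] (n : ℕ) (X : K.LinkSpace → ℝ≥0 → K.Space)
  (hX : Measurable fun q : K.LinkSpace × ℝ≥0 => X q.1 q.2) (η : ℝ≥0)

/-- The law of the next (position, direction, time) triple, given the present one and the waiting
time. -/
def jumpKernel : Kernel ((K.LinkSpace × ℝ≥0) × ℝ≥0) (K.LinkSpace × ℝ≥0) :=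
  (K.linkKernel n).comap (fun q => X q.1.1 (η * q.2))
      (hX.comp ((measurable_fst.comp measurable_fst).prodMk (measurable_snd.const_mul η))) ×ₖ
    Kernel.deterministic (fun q => q.1.2 + q.2) (by fun_prop)

/-- The transition probabilities of the isotropic transport process, as a kernel. -/
def transitionKernel : Kernel (K.LinkSpace × ℝ≥0) (K.LinkSpace × ℝ≥0) :=
  (Kernel.const _ expWaitingTime ⊗ₖ jumpKernel n X hX η).snd

variable {n X η} [IsMarkovKernel (K.linkKernel n)]

instance : IsMarkovKernel (jumpKernel n X hX η) := by
  unfold jumpKernel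
  infer_instance

instance : IsMarkovKernel (transitionKernel n X hX η) := by
  unfold transitionKernel
  infer_instance

theorem lintegral_jumpKernel (q : (K.LinkSpace × ℝ≥0) × ℝ≥0) {f : K.LinkSpace × ℝ≥0 → ℝ≥0∞}
    (hf : Measurable f) : ∫⁻ b, f b ∂jumpKernel n X hX η q =
      ∫⁻ z, f (z, q.1.2 + q.2) ∂K.uniformLink n (X q.1.1 (η * q.2)) := by
  have : IsProbabilityMeasure (K.uniformLink n (X q.1.1 (η * q.2))) :=
    IsMarkovKernel.isProbabilityMeasure (κ := K.linkKernel n) _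
  rw [jumpKernel, Kernel.prod_apply, Kernel.deterministic_apply, Kernel.comap_apply,
    linkKernel_apply, Measure.prod_dirac, lintegral_map hf (by fun_prop)]

theorem lintegral_transitionKernel (p : K.LinkSpace × ℝ≥0) {f : K.LinkSpace × ℝ≥0 → ℝ≥0∞}
    (hf : Measurable f) : ∫⁻ b, f b ∂transitionKernel n X hX η p =
      ∫⁻ r, ∫⁻ z, f (z, p.2 + r) ∂K.uniformLink n (X p.1 (η * r)) ∂expWaitingTime := by
  have hf' : Measurable fun q : ℝ≥0 × (K.LinkSpace × ℝ≥0) => f q.2 := hf.comp measurable_snd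
  rw [transitionKernel, Kernel.snd_apply, lintegral_map hf measurable_snd,
    Kernel.lintegral_compProd _ _ _ hf', Kernel.const_apply]
  exact lintegral_congr fun r => lintegral_jumpKernel hX (p, r) hf

theorem transitionKernel_apply_eq_lintegral (p : K.LinkSpace × ℝ≥0)
    {B : Set (K.LinkSpace × ℝ≥0)} (hB : MeasurableSet B) : transitionKernel n X hX η p B =
      ∫⁻ r, K.uniformLink n (X p.1 (η * r)) {z | (z, p.2 + r) ∈ B} ∂expWaitingTime := by
  rw [← lintegral_indicator_one hB,
    lintegral_transitionKernel hX p (measurable_one.indicator hB)]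
  refine lintegral_congr fun r => ?_
  have hm : MeasurableSet {z : K.LinkSpace | (z, p.2 + r) ∈ B} := measurable_prodMk_right hB
  rw [← lintegral_indicator_one hm]
  rfl

theorem transitionProb_eq (p : K.LinkSpace × ℝ≥0) {B : Set (K.LinkSpace × ℝ≥0)}
    (hB : MeasurableSet B) : transitionProb n X η p B = transitionKernel n X hX η p B := by
  rw [transitionKernel_apply_eq_lintegral hX p hB, lintegral_expWaitingTime]
  · rfl
  · have h : ∀ r, K.uniformLink n (X p.1 (η * r)) {z | (z, p.2 + r) ∈ B} =
        jumpKernel n X hX η (p, r) B := by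
      intro r
      have hm : MeasurableSet {z : K.LinkSpace | (z, p.2 + r) ∈ B} := measurable_prodMk_right hB
      rw [← lintegral_indicator_one hB, lintegral_jumpKernel hX _ (measurable_one.indicator hB),
        ← lintegral_indicator_one hm]
      rfl
    simp_rw [h]
    exact (Kernel.measurable_coe _ hB).comp measurable_prodMk_left

theorem isTransportLaw_iff {x : K.Space} {P : Measure (ℕ → K.LinkSpace × ℝ≥0)} :
    IsTransportLaw n X η x P ↔ IsMarkovChainLaw
      ((K.uniformLink n x).map fun z => (z, (0 : ℝ≥0))) (transitionKernel n X hX η) P := by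
  have h : ∀ (k : ℕ) (A : Set (Finset.Iic k → K.LinkSpace × ℝ≥0)) (B : Set (K.LinkSpace × ℝ≥0)),
      MeasurableSet B →
      ∫⁻ ω in {ω | (Finset.Iic k).restrict ω ∈ A}, transitionProb n X η (ω k) B ∂P =
        ∫⁻ ω in {ω | (Finset.Iic k).restrict ω ∈ A}, transitionKernel n X hX η (ω k) B ∂P :=
    fun k A B hB => lintegral_congr fun ω => transitionProb_eq hX _ hB
  constructor
  · rintro ⟨h1, h2, h3⟩
    exact ⟨h1, h2, fun k A B hA hB => (h3 k A B hA hB).trans (h k A B hB)⟩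
  · rintro ⟨h1, h2, h3⟩
    exact ⟨h1, h2, fun k A B hA hB => (h3 k A B hA hB).trans (h k A B hB).symm⟩

theorem measurableSet_jumpRelation {X : K.LinkSpace → ℝ≥0 → K.Space}
    (hX : Measurable fun q : K.LinkSpace × ℝ≥0 => X q.1 q.2) (η : ℝ≥0) :
    MeasurableSet {q : (K.LinkSpace × ℝ≥0) × (K.LinkSpace × ℝ≥0) |
      q.1.2 < q.2.2 ∧ K.base q.2.1 = X q.1.1 (η * (q.2.2 - q.1.2))} := by
  have hd : Measurable fun q : (K.LinkSpace × ℝ≥0) × (K.LinkSpace × ℝ≥0) =>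
      η * (q.2.2 - q.1.2) :=
    ((measurable_snd.comp measurable_snd).sub (measurable_snd.comp measurable_fst)).const_mul η
  exact (measurableSet_lt (by fun_prop) (by fun_prop)).inter (measurableSet_eq_fun
    (measurable_base.comp (measurable_fst.comp measurable_snd))
    (hX.comp ((measurable_fst.comp measurable_fst).prodMk hd)))

/-- The new direction is based at the point reached by following the trajectory for the waiting
time, which is positive. -/
theorem ae_transitionKernel (p : K.LinkSpace × ℝ≥0) : ∀ᵐ q ∂transitionKernel n X hX η p,
    p.2 < q.2 ∧ K.base q.1 = X p.1 (η * (q.2 - p.2)) := by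
  have hm : MeasurableSet {q : K.LinkSpace × ℝ≥0 |
      ¬ (p.2 < q.2 ∧ K.base q.1 = X p.1 (η * (q.2 - p.2)))} :=
    (measurable_prodMk_left (x := p) (measurableSet_jumpRelation hX η)).compl
  rw [ae_iff, transitionKernel_apply_eq_lintegral hX p hm]
  refine lintegral_eq_zero_of_ae_eq_zero ?_
  filter_upwards [ae_pos_expWaitingTime] with r hr
  refine ae_iff.1 ((ae_base_uniformLink n (X p.1 (η * r))).mono fun z hz => ⟨?_, ?_⟩)
  · exact lt_add_of_pos_right _ hr
  · rw [hz, add_tsub_cancel_left]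

/-- The expectation of `exp (-τ)` is halved at each step. -/
theorem lintegral_exp_neg_transitionKernel (p : K.LinkSpace × ℝ≥0) :
    ∫⁻ q, ENNReal.ofReal (Real.exp (-(q.2 : ℝ))) ∂transitionKernel n X hX η p =
      2⁻¹ * ENNReal.ofReal (Real.exp (-(p.2 : ℝ))) := by
  rw [lintegral_transitionKernel hX p (by fun_prop), ← lintegral_exp_neg_expWaitingTime, mul_comm,
    ← lintegral_const_mul _ (by fun_prop)]
  refine lintegral_congr fun r => ?_
  have : IsProbabilityMeasure (K.uniformLink n (X p.1 (η * r))) :=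
    IsMarkovKernel.isProbabilityMeasure (κ := K.linkKernel n) _
  dsimp only
  rw [lintegral_const, measure_univ, mul_one, ← ENNReal.ofReal_mul (Real.exp_pos _).le,
    ← Real.exp_add, NNReal.coe_add, neg_add]

end Chain

/-! ### The isotropic transport process -/

section TransportProcess

variable {X : K.LinkSpace → ℝ≥0 → K.Space}

instance : BorelSpace (OnePoint K.Space) := ⟨rfl⟩

instance : BorelSpace C(ℝ≥0, K.Space) := ⟨rfl⟩

theorem measurable_transportProcess [Countable V]
    (hX : Measurable fun q : K.LinkSpace × ℝ≥0 => X q.1 q.2) (η t : ℝ≥0) :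
    Measurable (transportProcess X η t) := by
  classical
  let p : ℕ → (ℕ → K.LinkSpace × ℝ≥0) → Prop := fun i ω =>
    (ω i).2 ≤ t / η ^ 2 ∧ t / η ^ 2 < (ω (i + 1)).2
  have hp : ∀ i, MeasurableSet {ω | p i ω} := fun i =>
    (measurableSet_le (by fun_prop) measurable_const).inter
      (measurableSet_lt measurable_const (by fun_prop))
  let f : ℕ → (ℕ → K.LinkSpace × ℝ≥0) → OnePoint K.Space := fun i ω =>
    if p i ω then ((X (ω i).1 (η * (t / η ^ 2 - (ω i).2)) : K.Space) : OnePoint K.Space)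
    else OnePoint.infty
  have hf : ∀ i, Measurable (f i) := by
    intro i
    refine Measurable.ite (hp i) ?_ measurable_const
    have h : Measurable fun ω : ℕ → K.LinkSpace × ℝ≥0 =>
        ((ω i).1, η * (t / η ^ 2 - (ω i).2)) :=
      (measurable_fst.comp (measurable_pi_apply i)).prodMk
        ((measurable_const.sub (measurable_snd.comp (measurable_pi_apply i))).const_mul η)
    exact measurableEmbedding_coe_onePoint.measurable.comp (hX.comp h)
  -- The index condition is relaxed so that some index satisfies it also when the process is in
  -- the cemetery.
  have hex : ∀ ω, ∃ i, p i ω ∨ ∀ j, ¬ p j ω := by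
    intro ω
    by_cases h : ∃ i, p i ω
    · exact h.imp fun i hi => Or.inl hi
    · exact ⟨0, Or.inr (not_exists.1 h)⟩
  have hq : ∀ i, MeasurableSet {ω | p i ω ∨ ∀ j, ¬ p j ω} := by
    intro i
    have : {ω | p i ω ∨ ∀ j, ¬ p j ω} = {ω | p i ω} ∪ ⋂ j, {ω | p j ω}ᶜ := by ext ω; simp
    rw [this]
    exact (hp i).union (MeasurableSet.iInter fun j => (hp j).compl)
  have key : transportProcess X η t = fun ω => f (Nat.find (hex ω)) ω := by
    ext1 ω
    by_cases h : ∃ i, p i ω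
    · have hfind : Nat.find (hex ω) = Nat.find h := by
        refine Nat.find_congr' fun {i} => ⟨fun hi => ?_, Or.inl⟩
        exact hi.resolve_right fun hn => h.elim hn
      rw [transportProcess, dif_pos h, hfind]
      exact (if_pos (Nat.find_spec h)).symm
    · rw [transportProcess, dif_neg h]
      exact (if_neg (not_exists.1 h _)).symm
  rw [key]
  exact Measurable.find hf hq hex

/-- The path is continuous if the times increase to infinity and each direction is based at
the point where the preceding trajectory ends. -/
theorem exists_continuousMap_transportProcess (hXc : ∀ z, Continuous (X z))
    (hX0 : ∀ z, X z 0 = K.base z) (η : ℝ≥0) {ω : ℕ → K.LinkSpace × ℝ≥0} (h0 : (ω 0).2 = 0)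
    (hstep : ∀ k, (ω k).2 < (ω (k + 1)).2 ∧
      K.base (ω (k + 1)).1 = X (ω k).1 (η * ((ω (k + 1)).2 - (ω k).2)))
    (htop : ∀ t, ∃ k, t < (ω k).2) :
    ∃ f : C(ℝ≥0, K.Space), ∀ t, transportProcess X η t ω = (f t : OnePoint K.Space) := by
  have hmono : StrictMono fun k => (ω k).2 := strictMono_nat_of_lt_succ fun k => (hstep k).1
  obtain ⟨f, hf⟩ := exists_continuousMap_concat hmono h0 htop
    (g := fun i t => X (ω i).1 (η * (t - (ω i).2)))
    (fun i => (hXc _).comp (by fun_prop)) fun i => by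
      simp only [tsub_self, mul_zero, hX0, (hstep i).2]
  refine ⟨⟨fun t => f (t / η ^ 2), by fun_prop⟩, fun t => ?_⟩
  have hex := exists_le_and_lt_succ h0 htop (t / η ^ 2)
  classical
  rw [transportProcess, dif_pos hex]
  congr 1
  exact (hf _ _ (Nat.find_spec hex).1 (Nat.find_spec hex).2).symm

variable [Countable V] {n : ℕ} [IsMarkovKernel (K.linkKernel n)] {η : ℝ≥0} {x : K.Space}
  {P : Measure (ℕ → K.LinkSpace × ℝ≥0)}

/-- The times tend to infinity, because the expectations of `exp (-τ_k)` form a convergent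
geometric series. -/
theorem ae_exists_lt_time (hX : Measurable fun q : K.LinkSpace × ℝ≥0 => X q.1 q.2)
    {μ₀ : Measure (K.LinkSpace × ℝ≥0)}
    (hP : IsMarkovChainLaw μ₀ (transitionKernel n X hX η) P) :
    ∀ᵐ ω ∂P, ∀ t, ∃ k, t < (ω k).2 := by
  have := hP.isProbabilityMeasure
  let g : K.LinkSpace × ℝ≥0 → ℝ≥0∞ := fun q => ENNReal.ofReal (Real.exp (-(q.2 : ℝ)))
  have hg : Measurable g := by fun_prop
  have hgω : ∀ k, Measurable fun ω : ℕ → K.LinkSpace × ℝ≥0 => g (ω k) := fun k =>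
    hg.comp (measurable_pi_apply k)
  have hexp : ∀ k, ∫⁻ ω, g (ω k) ∂P ≤ 2⁻¹ ^ k := by
    intro k
    induction k with
    | zero =>
      rw [pow_zero]
      calc ∫⁻ ω, g (ω 0) ∂P ≤ ∫⁻ _, 1 ∂P := lintegral_mono fun ω => by
            simp only [g, ENNReal.ofReal_le_one, Real.exp_le_one_iff]
            exact neg_nonpos.2 (NNReal.coe_nonneg _)
        _ = 1 := by simp
    | succ k ih =>
      rw [hP.lintegral_succ hg]
      simp_rw [g, lintegral_exp_neg_transitionKernel hX]
      rw [lintegral_const_mul _ (hgω k), pow_succ']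
      exact mul_le_mul_right ih _
  have hsum : ∫⁻ ω, ∑' k, g (ω k) ∂P ≠ ∞ := by
    rw [lintegral_tsum fun k => (hgω k).aemeasurable]
    refine ne_top_of_le_ne_top ?_ (ENNReal.tsum_le_tsum hexp)
    rw [ENNReal.tsum_geometric]
    simp
  filter_upwards [ae_lt_top' (Measurable.tsum hgω).aemeasurable hsum] with ω hω t
  have hlim := ENNReal.tendsto_atTop_zero_of_tsum_ne_top hω.ne
  obtain ⟨k, hk⟩ := (hlim.eventually (gt_mem_nhds
    (ENNReal.ofReal_pos.2 (Real.exp_pos (-(t : ℝ)))))).exists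
  refine ⟨k, ?_⟩
  rw [ENNReal.ofReal_lt_ofReal_iff (Real.exp_pos _), Real.exp_lt_exp, neg_lt_neg_iff] at hk
  exact_mod_cast hk

theorem ae_exists_continuousMap_transportProcess
    (hX : Measurable fun q : K.LinkSpace × ℝ≥0 => X q.1 q.2) (hXc : ∀ z, Continuous (X z))
    (hX0 : ∀ z, X z 0 = K.base z)
    (hP : IsMarkovChainLaw ((K.uniformLink n x).map fun z => (z, (0 : ℝ≥0)))
      (transitionKernel n X hX η) P) :
    ∀ᵐ ω ∂P, ∃ f : C(ℝ≥0, K.Space), ∀ t,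
      transportProcess X η t ω = (f t : OnePoint K.Space) := by
  have h0 : ∀ᵐ ω ∂P, (ω 0).2 = 0 := by
    refine hP.ae_zero (p := fun q => q.2 = 0) ?_
    rw [ae_map_iff (by fun_prop) (measurableSet_eq_fun (by fun_prop) measurable_const)]
    exact Eventually.of_forall fun _ => rfl
  filter_upwards [h0, hP.ae_step (measurableSet_jumpRelation hX η) (ae_transitionKernel hX),
    ae_exists_lt_time hX hP] with ω h1 h2 h3
  exact exists_continuousMap_transportProcess hXc hX0 η h1 h2 h3

end TransportProcess

end RiemannianComplex

end

theorem proposition3p1 {V : Type*} (K : RiemannianComplex V) (n : ℕ) (hn : 1 ≤ n)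
    (hK : K.IsAdmissible n) (X : K.LinkSpace → ℝ≥0 → K.Space) (hX : K.IsGeodesicFlow n X)
    (η : ℝ≥0) (hη : 0 < η) (x : K.Space) :
    ∃ P : Measure (ℕ → K.LinkSpace × ℝ≥0),
      RiemannianComplex.IsTransportLaw n X η x P ∧
      (∀ P', RiemannianComplex.IsTransportLaw n X η x P' → P' = P) ∧
      (∀ t, AEMeasurable (RiemannianComplex.transportProcess X η t) P) ∧
      (∀ᵐ ω ∂P, ∃ f : C(ℝ≥0, K.Space), ∀ t,
        RiemannianComplex.transportProcess X η t ω = (f t : OnePoint K.Space)) ∧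
      IsProjectiveMeasureFamily (α := fun _ : ℝ≥0 => OnePoint K.Space)
        (RiemannianComplex.finiteDimLaw X η P) ∧
      ∃! μ : Measure C(ℝ≥0, K.Space), IsProbabilityMeasure μ ∧
        ∀ J : Finset ℝ≥0,
          μ.map (fun f (t : J) => ((f t : K.Space) : OnePoint K.Space)) =
            RiemannianComplex.finiteDimLaw X η P J := by
  have := hK.1
  have := K.countable_vertices
  have := RiemannianComplex.isMarkovKernel_linkKernel hn hK
  have := RiemannianComplex.isProbabilityMeasure_uniformLink hn hK x
  have hXm := hX.measurable_uncurry
  have : IsProbabilityMeasure ((K.uniformLink n x).map fun z => (z, (0 : ℝ≥0))) :=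
    Measure.isProbabilityMeasure_map (by fun_prop)
  obtain ⟨P, hP⟩ := exists_isMarkovChainLaw ((K.uniformLink n x).map fun z => (z, (0 : ℝ≥0)))
    (RiemannianComplex.transitionKernel n X hXm η)
  have := hP.isProbabilityMeasure
  have hY := RiemannianComplex.measurable_transportProcess hXm η
  have hcont := RiemannianComplex.ae_exists_continuousMap_transportProcess hXm hX.continuous
    hX.zero hP
  refine ⟨P, (RiemannianComplex.isTransportLaw_iff hXm).2 hP,
    fun P' hP' => ((RiemannianComplex.isTransportLaw_iff hXm).1 hP').eq hP,
    fun t => (hY t).aemeasurable, hcont, fun I J hJI => ?_, existsUnique_pathMeasure hY hcont⟩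
  have hYI : Measurable fun ω (t : I) => RiemannianComplex.transportProcess X η t ω :=
    measurable_pi_iff.2 fun t => hY t
  exact (Measure.map_map (g := Finset.restrict₂ (π := fun _ => OnePoint K.Space) hJI)
    (Finset.measurable_restrict₂ hJI) hYI).symm
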